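/- An $(n,r,b)$-matroid is a matroid with $n$ elements, rank $r$ and exactly $b$ bases. It is called linear here if it is the column matroid of an $r\times n$ matrix $A$ over $\mathbb{Q}$, that is, its elements are the $n$ columns of $A$ (columns in different positions count as different elements) and its independent sets are the linearly independent collections of columns. Theorem. Let $n,r,b$ be nonnegative integers with $(n,r,b)\neq(6,3,11)$. (a) If $1\le b\le\binom{r+3}{r}$ and $b\le\binom{n}{r}$, then a linear $(n,r,b)$-matroid exists. (b) In particular, if $r\le n\le r+3$ and $1\le b\le\binom{n}{r}$ (corank at most $3$), then a linear $(n,r,b)$-matroid exists. (c) The triple $(6,3,11)$ is a genuine exception: there is no $(6,3,11)$-matroid, linear (over any field) or not. -/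

import Mathlib

/-- The column matroid of a matrix `A` over a field: the ground set is the set of (indices of)
columns of `A`, and a collection of columns is independent when it is linearly independent
(repeated columns count as different elements). -/
def Matrix.columnMatroid {m ι F : Type*} [Field F] [Finite ι] (A : Matrix m ι F) : Matroid ι :=
  (IndepMatroid.ofFinite (E := Set.univ) Set.finite_univ
    (fun I => LinearIndepOn F A.col I)
    (linearIndepOn_empty F A.col)
    (fun _ _ hJ hIJ => hJ.mono hIJ)
    (by
      intro I J hI hJ hlt
      by_contra hcon
      push Not at hcon
      have hsub : A.col '' J ⊆ Submodule.span F (A.col '' I) := by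
        rintro _ ⟨e, he, rfl⟩
        by_cases heI : e ∈ I
        · exact Submodule.subset_span ⟨e, heI, rfl⟩
        · by_contra hspan
          exact hcon e he heI ((linearIndepOn_insert heI).2 ⟨hI, hspan⟩)
      have hle : Submodule.span F (A.col '' J) ≤ Submodule.span F (A.col '' I) :=
        Submodule.span_le.2 hsub
      have hfin : ∀ K : Set ι, LinearIndepOn F A.col K →
          Module.finrank F (Submodule.span F (A.col '' K)) = K.ncard := by
        intro K hK
        have : Fintype K := Fintype.ofFinite K
        have h := finrank_span_eq_card hK.linearIndependent
        rw [← Set.image_eq_range] at h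
        rw [h, ← Nat.card_eq_fintype_card, Nat.card_coe_set_eq]
      have : FiniteDimensional F (Submodule.span F (A.col '' I)) :=
        FiniteDimensional.span_of_finite F (Set.toFinite _)
      have hmono := Submodule.finrank_mono hle
      rw [hfin I hI, hfin J hJ] at hmono
      omega)
    (fun _ _ => Set.subset_univ _)).matroid

/-- `M` is an `(n, r, b)`-matroid: it has exactly `n` elements, rank `r` and exactly `b` bases. -/
def Matroid.IsTriple {α : Type*} (M : Matroid α) (n r b : ℕ) : Prop :=
  M.E.encard = n ∧ M.eRank = r ∧ {B : Set α | M.IsBase B}.encard = b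

/-- A linear `(n, r, b)`-matroid exists: some `r × n` matrix with rational entries has a column
matroid of rank `r` with exactly `b` bases. -/
def ExistsLinearMatroid (n r b : ℕ) : Prop :=
  ∃ A : Matrix (Fin r) (Fin n) ℚ, A.columnMatroid.IsTriple n r b

/-!
By orthogonal duality the complements of the bases of a linear `(n, r, b)`-matroid are the bases
of a linear `(n, n - r, b)`-matroid (`ExistsLinearMatroid.dual`), so corank at most three reduces to
rank at most three; more than `r + 3` elements are reached by adding loops. Everything then rests
on rank three (`existsLinearMatroid_three`); ranks zero, one and two are easy.

In rank three one counts the number `c = n.choose 3 - b` of dependent triples among `n` vectors of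
`ℚ^3`. Adding a loop to `n - 1` vectors settles `b ≤ (n - 1).choose 3`, so only
`c < (n - 1).choose 2` is left. Two generic constructions change `c` in a controlled way:

* to a simple configuration one may add `k - 1` vectors that form, together with an old one, a new
  line of `k` points in general position, which adds `k.choose 3` to `c` (`IsConfig.addLine`);
* to a loopless configuration one may add a generic parallel class (`IsConfig.addClass`).

For `n ≥ 45` a single line with about `√(6 n)` points lowers `c` into the range already reached by
the remaining vectors (`isConfig_of_large`). For smaller `n` a search through these two
constructions, started from ten explicit simple configurations and evaluated by the kernel, reaches
every `c` except for nine sporadic pairs `(n, c)`; eight of them are realized by explicit vectors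
and the ninth, `(6, 9)`, is the exception `(6, 3, 11)`. For the same reason `(7, 3, 11)`, which the
exception withholds from the addition of a loop, needs explicit vectors.

A `(6, 3, 11)`-matroid has nine dependent triples. If it is simple, these share a pair and so force
a line of four points, which leaves room for at most eight (`card_ne_eleven_of_simple`). It has no
loop, as that would leave at most ten bases, and if two of its elements are parallel, then it has
`2 * N + X` bases with `N ≤ 6` and `X ≤ 4`, where the solutions `(5, 1)` and `(4, 3)` of
`2 * N + X = 11` violate basis exchange (`card_ne_eleven_of_parallel`).
-/

open Module

/-! ### Column matroids and duality -/

lemma Matrix.columnMatroid_indep {m ι F : Type*} [Field F] [Finite ι] (A : Matrix m ι F)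
    (I : Set ι) : A.columnMatroid.Indep I ↔ LinearIndepOn F A.col I := by
  simp [Matrix.columnMatroid]

lemma Matrix.columnMatroid_ground {m ι F : Type*} [Field F] [Finite ι] (A : Matrix m ι F) :
    A.columnMatroid.E = Set.univ := rfl

lemma Matrix.ncard_le_of_linearIndepOn_col {r : ℕ} {ι : Type*} [Finite ι]
    {A : Matrix (Fin r) ι ℚ} {B : Set ι} (hB : LinearIndepOn ℚ A.col B) : B.ncard ≤ r := by
  have := Fintype.ofFinite B
  have h := hB.linearIndependent.fintype_card_le_finrank
  rw [← Nat.card_eq_fintype_card, Nat.card_coe_set_eq] at h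
  simpa using h

/-- The sets of `r` linearly independent columns of a matrix with `r` rows. -/
def Matrix.colBases {r : ℕ} {ι : Type*} (A : Matrix (Fin r) ι ℚ) : Set (Set ι) :=
  {B | LinearIndepOn ℚ A.col B ∧ B.ncard = r}

lemma Matrix.isBase_columnMatroid_iff {r : ℕ} {ι : Type*} [Finite ι] {A : Matrix (Fin r) ι ℚ}
    (hA : A.colBases.Nonempty) (B : Set ι) :
    A.columnMatroid.IsBase B ↔ B ∈ A.colBases := by
  have key : ∀ B ∈ A.colBases, A.columnMatroid.IsBase B := by
    rintro B ⟨hB, hBr⟩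
    rw [Matroid.isBase_iff_maximal_indep]
    refine ⟨(A.columnMatroid_indep B).2 hB, fun J hJ hBJ => ?_⟩
    rw [A.columnMatroid_indep] at hJ
    have h1 := Matrix.ncard_le_of_linearIndepOn_col hJ
    exact (Set.eq_of_subset_of_ncard_le hBJ (by omega) (Set.toFinite _)).ge
  refine ⟨fun hB => ⟨(A.columnMatroid_indep B).1 hB.indep, ?_⟩, key B⟩
  obtain ⟨B₀, hB₀⟩ := hA
  rw [hB.ncard_eq_ncard_of_isBase (key B₀ hB₀), hB₀.2]

/-- For a positive number `b` of bases, the rank condition in the definition of an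
`(n, r, b)`-matroid is automatic. -/
lemma existsLinearMatroid_iff {n r b : ℕ} (hb : 1 ≤ b) :
    ExistsLinearMatroid n r b ↔
      ∃ A : Matrix (Fin r) (Fin n) ℚ, A.colBases.encard = b := by
  constructor
  · rintro ⟨A, -, hr, hbs⟩
    have hne : A.colBases.Nonempty := by
      obtain ⟨B, hB⟩ := A.columnMatroid.exists_isBase
      refine ⟨B, (A.columnMatroid_indep B).1 hB.indep, ?_⟩
      have h := hB.encard_eq_eRank
      rw [hr] at h
      rw [Set.ncard, h, ENat.toNat_natCast]
    refine ⟨A, ?_⟩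
    rw [← hbs]
    congr 1
    ext B
    exact (Matrix.isBase_columnMatroid_iff hne B).symm
  · rintro ⟨A, hA⟩
    have hne : A.colBases.Nonempty := by
      rw [← Set.encard_ne_zero, hA]
      exact_mod_cast (by omega : b ≠ 0)
    have hiff := Matrix.isBase_columnMatroid_iff hne
    refine ⟨A, ?_, ?_, ?_⟩
    · simp [Matrix.columnMatroid_ground, Set.encard_univ]
    · obtain ⟨B, hB⟩ := hne
      rw [← ((hiff B).2 hB).encard_eq_eRank, ← hB.2, Set.Finite.cast_ncard_eq (Set.toFinite _)]
    · rw [← hA]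
      congr 1
      ext B
      exact hiff B

/-- Columns indexed by the complement of `Y` are independent when no nonzero vector of the
kernel vanishes on `Y`. -/
lemma Matrix.linearIndepOn_col_compl_iff {s n : ℕ} (A : Matrix (Fin s) (Fin n) ℚ)
    (Y : Set (Fin n)) :
    LinearIndepOn ℚ A.col Yᶜ ↔
      ∀ x : Fin n → ℚ, A.mulVec x = 0 → (∀ j ∈ Y, x j = 0) → x = 0 := by
  rw [linearIndepOn_iff]
  have hlin : ∀ l : Fin n →₀ ℚ, Finsupp.linearCombination ℚ A.col l = A.mulVec l := by
    intro l
    rw [Finsupp.linearCombination_apply, Finsupp.sum_fintype _ _ (by simp)]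
    ext i
    simp [Matrix.mulVec, dotProduct, Matrix.col, mul_comm]
  have hsupp : ∀ l : Fin n →₀ ℚ, l ∈ Finsupp.supported ℚ ℚ Yᶜ ↔ ∀ j ∈ Y, l j = 0 := by
    intro l
    rw [Finsupp.mem_supported']
    simp
  constructor
  · intro h x hx hY
    have := h (Finsupp.equivFunOnFinite.symm x) ((hsupp _).2 (by simpa using hY))
      (by rw [hlin]; simpa using hx)
    simpa using congrArg (fun l : Fin n →₀ ℚ => (l : Fin n → ℚ)) this
  · intro h l hl h0
    rw [hlin] at h0
    exact DFunLike.coe_injective (h l h0 ((hsupp l).1 hl))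

/-- Orthogonal duality: if the rows of `K` form a basis of the kernel of `A`, then `r` columns
of `K` are independent exactly when the complementary columns of `A` are. -/
lemma Matrix.linearIndepOn_kernel_col_iff {r s n : ℕ} (A : Matrix (Fin s) (Fin n) ℚ)
    (β : Basis (Fin r) ℚ (LinearMap.ker A.mulVecLin)) (Y : Set (Fin n)) (hY : Y.ncard = r) :
    LinearIndepOn ℚ (Matrix.of fun i j => (β i : Fin n → ℚ) j).col Y ↔
      LinearIndepOn ℚ A.col Yᶜ := by
  classical
  have := Fintype.ofFinite Y
  have hcard : Fintype.card Y = r := by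
    rw [← Nat.card_eq_fintype_card, Nat.card_coe_set_eq, hY]
  set K : Matrix (Fin r) (Fin n) ℚ := Matrix.of fun i j => (β i : Fin n → ℚ) j with hK
  let M : Matrix (Fin r) Y ℚ := K.submatrix id (fun j => (j : Fin n))
  -- `M` is square, so its columns are independent exactly when its rows are
  have hrc : LinearIndepOn ℚ K.col Y ↔ LinearIndependent ℚ M.row := by
    have h1 : LinearIndepOn ℚ K.col Y ↔ LinearIndependent ℚ M.col := Iff.rfl
    rw [h1, linearIndependent_iff_card_eq_finrank_span, linearIndependent_iff_card_eq_finrank_span,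
      Set.finrank, Set.finrank, ← Matrix.rank_eq_finrank_span_cols,
      ← Matrix.rank_eq_finrank_span_row, hcard, Fintype.card_fin]
  rw [hrc, Matrix.linearIndepOn_col_compl_iff, Fintype.linearIndependent_iff]
  have hsum : ∀ (g : Fin r → ℚ) (j : Fin n),
      ((∑ i, g i • β i : LinearMap.ker A.mulVecLin) : Fin n → ℚ) j = ∑ i, g i * K i j := by
    intro g j
    simp [hK, Finset.sum_apply]
  have hrow : ∀ g : Fin r → ℚ, ∑ i, g i • M.row i = 0 ↔
      ∀ j ∈ Y, ((∑ i, g i • β i : LinearMap.ker A.mulVecLin) : Fin n → ℚ) j = 0 := by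
    intro g
    constructor
    · intro h j hj
      have := congrFun h ⟨j, hj⟩
      rw [hsum]
      simpa [M, Matrix.row, Finset.sum_apply] using this
    · intro h
      ext ⟨j, hj⟩
      have := h j hj
      rw [hsum] at this
      simpa [M, Matrix.row, Finset.sum_apply] using this
  constructor
  · intro h x hx hxY
    have hrep := β.sum_repr ⟨x, hx⟩
    have h0 := h (fun i => β.repr ⟨x, hx⟩ i) ((hrow _).2 (by rw [hrep]; exact hxY))
    simp only [h0, zero_smul, Finset.sum_const_zero] at hrep
    exact (congrArg Subtype.val hrep).symm
  · intro h g hg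
    have h0 := h _ (∑ i, g i • β i : LinearMap.ker A.mulVecLin).2 ((hrow g).1 hg)
    exact Fintype.linearIndependent_iff.1 β.linearIndependent g (Subtype.ext h0)

lemma ExistsLinearMatroid.dual {r s n b : ℕ} (hn : n = r + s) (hb : 1 ≤ b)
    (h : ExistsLinearMatroid n s b) : ExistsLinearMatroid n r b := by
  rw [existsLinearMatroid_iff hb] at h ⊢
  obtain ⟨A, hA⟩ := h
  have hne : A.colBases.Nonempty := by
    rw [← Set.encard_ne_zero, hA]
    exact_mod_cast (by omega : b ≠ 0)
  obtain ⟨B₀, hB₀, hB₀s⟩ := hne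
  have hrank : s ≤ A.rank := by
    have := Fintype.ofFinite B₀
    rw [Matrix.rank_eq_finrank_span_cols]
    refine hB₀s.ge.trans ?_
    have h1 := finrank_span_eq_card hB₀.linearIndependent
    rw [← Nat.card_eq_fintype_card, Nat.card_coe_set_eq] at h1
    rw [← h1]
    refine Submodule.finrank_mono (Submodule.span_mono ?_)
    rintro _ ⟨j, rfl⟩
    exact ⟨j, rfl⟩
  have hker : finrank ℚ (LinearMap.ker A.mulVecLin) = r := by
    have h1 := A.mulVecLin.finrank_range_add_finrank_ker
    have h2 := A.rank_le_height
    rw [Matrix.rank] at hrank h2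
    simp only [finrank_fin_fun] at h1
    omega
  let β := finBasisOfFinrankEq ℚ (LinearMap.ker A.mulVecLin) hker
  set K : Matrix (Fin r) (Fin n) ℚ := Matrix.of fun i j => (β i : Fin n → ℚ) j with hK
  refine ⟨K, ?_⟩
  rw [← hA, ← Set.InjOn.encard_image (f := compl) (s := A.colBases) compl_injective.injOn]
  congr 1
  ext Y
  have hcompl : ∀ Y : Set (Fin n), Y.ncard + Yᶜ.ncard = n := fun Y => by
    simpa using Set.ncard_add_ncard_compl Y
  have hY := hcompl Y
  simp only [Matrix.colBases, Set.mem_ofPred_eq, Set.mem_image]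
  constructor
  · rintro ⟨h1, h2⟩
    exact ⟨Yᶜ, ⟨(A.linearIndepOn_kernel_col_iff β Y h2).1 h1, by omega⟩, compl_compl Y⟩
  · rintro ⟨B, ⟨h1, h2⟩, rfl⟩
    have h3 : Bᶜ.ncard = r := by have := hcompl B; omega
    exact ⟨(A.linearIndepOn_kernel_col_iff β Bᶜ h3).2 (by rwa [compl_compl]), h3⟩

/-! ### Counting bases by dependent multisets of vectors -/

/-- A multiset of vectors is linearly independent when its span has dimension its cardinality,
so a repeated vector is a dependency. -/
def Multiset.LinIndep {V : Type*} [AddCommGroup V] [Module ℚ V] (T : Multiset V) : Prop :=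
  finrank ℚ (Submodule.span ℚ {x | x ∈ T}) = T.card

open Classical in
/-- The number of dependent `k`-element submultisets of `S`, counted with multiplicity. -/
noncomputable def Multiset.numDep {V : Type*} [AddCommGroup V] [Module ℚ V] (k : ℕ)
    (S : Multiset V) : ℕ :=
  (S.powersetCard k).countP fun T => ¬ T.LinIndep

section Basic

variable {V : Type*} [AddCommGroup V] [Module ℚ V]

lemma Multiset.finrank_span_le_card (T : Multiset V) :
    finrank ℚ (Submodule.span ℚ {x | x ∈ T}) ≤ T.card := by
  classical
  have h := finrank_span_finset_le_card (R := ℚ) T.toFinset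
  have h2 : ((T.toFinset : Finset V) : Set V) = {x | x ∈ T} := by ext; simp
  rw [Set.finrank, h2] at h
  exact h.trans T.toFinset_card_le

lemma Multiset.linIndep_zero : (0 : Multiset V).LinIndep := by
  have h : {x : V | x ∈ (0 : Multiset V)} = ∅ := by ext; simp
  rw [Multiset.LinIndep, h, Submodule.span_empty, finrank_bot, Multiset.card_zero]

open Classical in
lemma Multiset.numDep_add_countP (k : ℕ) (S : Multiset V) :
    S.numDep k + (S.powersetCard k).countP Multiset.LinIndep = S.card.choose k := by
  rw [← Multiset.card_powersetCard, Multiset.card_eq_countP_add_countP Multiset.LinIndep, add_comm]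
  rfl

open Classical in
lemma Multiset.numDep_cons (k : ℕ) (w : V) (S : Multiset V) :
    (w ::ₘ S).numDep (k + 1) =
      S.numDep (k + 1) + (S.powersetCard k).countP fun T => ¬ (w ::ₘ T).LinIndep := by
  unfold Multiset.numDep
  rw [Multiset.powersetCard_cons, Multiset.countP_add, Multiset.countP_map,
    ← Multiset.countP_eq_card_filter]

variable [FiniteDimensional ℚ V]

lemma Multiset.linIndep_cons {w : V} {T : Multiset V} :
    (w ::ₘ T).LinIndep ↔ T.LinIndep ∧ w ∉ Submodule.span ℚ {x | x ∈ T} := by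
  have hset : {x | x ∈ w ::ₘ T} = insert w {x | x ∈ T} := by ext; simp
  have hle := T.finrank_span_le_card
  unfold Multiset.LinIndep
  rw [hset, Multiset.card_cons]
  by_cases hw : w ∈ Submodule.span ℚ {x | x ∈ T}
  · rw [Submodule.span_insert_eq_span hw]
    constructor
    · intro h; omega
    · exact fun h => absurd hw h.2
  · rw [Submodule.span_insert, sup_comm, Submodule.finrank_sup_span_singleton hw]
    simp [hw]

lemma Multiset.linIndep_singleton {x : V} : ({x} : Multiset V).LinIndep ↔ x ≠ 0 := by
  rw [← Multiset.cons_zero, Multiset.linIndep_cons]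
  simp [Multiset.linIndep_zero]

lemma Multiset.linIndep_pair {x y : V} :
    ({x, y} : Multiset V).LinIndep ↔ y ≠ 0 ∧ x ∉ Submodule.span ℚ {y} := by
  rw [Multiset.insert_eq_cons, Multiset.linIndep_cons, Multiset.linIndep_singleton]
  simp

lemma Multiset.LinIndep.of_le {S T : Multiset V} (hT : T.LinIndep) (hST : S ≤ T) :
    S.LinIndep := by
  obtain ⟨U, rfl⟩ := Multiset.le_iff_exists_add.1 hST
  clear hST
  induction U using Multiset.induction with
  | empty => simpa using hT
  | cons a U ih =>
    rw [Multiset.add_cons, Multiset.linIndep_cons] at hT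
    exact ih hT.1

/-- A zero vector is a loop: it lies in no independent set. -/
lemma Multiset.numDep_zero_cons (k : ℕ) (S : Multiset V) :
    ((0 : V) ::ₘ S).numDep (k + 1) = S.numDep (k + 1) + S.card.choose k := by
  classical
  rw [Multiset.numDep_cons, ← Multiset.card_powersetCard, Multiset.countP_eq_card.2]
  intro T _ h
  exact (Multiset.linIndep_cons.1 h).2 (Submodule.zero_mem _)

end Basic

lemma Multiset.linIndep_map_val_iff {ι V : Type*} [AddCommGroup V] [Module ℚ V] (v : ι → V)
    (B : Finset ι) : (B.val.map v).LinIndep ↔ LinearIndepOn ℚ v (B : Set ι) := by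
  have h1 : LinearIndepOn ℚ v (B : Set ι) ↔ LinearIndependent ℚ (fun i : B => v i) := Iff.rfl
  rw [h1, linearIndependent_iff_card_eq_finrank_span, Fintype.card_coe, Multiset.LinIndep,
    Set.finrank, Multiset.card_map, Finset.card_val, eq_comm]
  have h2 : {x | x ∈ B.val.map v} = Set.range (fun i : B => v i) := by
    ext x
    simp
  rw [h2]

open Classical in
lemma Matrix.encard_colBases {r n : ℕ} (A : Matrix (Fin r) (Fin n) ℚ) :
    A.colBases.encard =
      (((Finset.univ.val.map A.col).powersetCard r).countP Multiset.LinIndep : ℕ) := by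
  have hset : A.colBases = (fun B : Finset (Fin n) => (B : Set (Fin n))) ''
      (((Finset.univ.powersetCard r).filter fun B => (B.val.map A.col).LinIndep :
        Finset (Finset (Fin n))) : Set (Finset (Fin n))) := by
    ext B
    simp only [Matrix.colBases, Set.mem_ofPred_eq, Set.mem_image, Finset.mem_coe,
      Finset.mem_filter, Finset.mem_powersetCard, Multiset.linIndep_map_val_iff]
    constructor
    · rintro ⟨h1, h2⟩
      refine ⟨B.toFinset, ⟨⟨Finset.subset_univ _, ?_⟩, by simpa using h1⟩, by simp⟩
      exact (Set.ncard_eq_toFinset_card' B).symm.trans h2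
    · rintro ⟨C, ⟨⟨-, h1⟩, h2⟩, rfl⟩
      exact ⟨h2, by simpa using h1⟩
  rw [hset, Set.InjOn.encard_image Finset.coe_injective.injOn, Set.encard_coe_eq_coe_finsetCard,
    Multiset.powersetCard_map, ← Finset.map_val_val_powersetCard, Multiset.countP_map,
    Multiset.filter_map, Multiset.card_map]
  rfl

/-- Counting bases as vectors: for `b ≥ 1`, a linear `(n, r, b)`-matroid is a multiset of `n`
vectors of `ℚ^r` all but `b` of whose `r`-element submultisets are dependent. -/
lemma existsLinearMatroid_iff_numDep {n r b : ℕ} (hb : 1 ≤ b) :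
    ExistsLinearMatroid n r b ↔
      ∃ S : Multiset (Fin r → ℚ), S.card = n ∧ S.numDep r + b = n.choose r := by
  classical
  rw [existsLinearMatroid_iff hb]
  have key : ∀ A : Matrix (Fin r) (Fin n) ℚ, A.colBases.encard = b ↔
      (Finset.univ.val.map A.col).numDep r + b = n.choose r := by
    intro A
    have hsum := Multiset.numDep_add_countP r (Finset.univ.val.map A.col)
    rw [Multiset.card_map, Finset.card_val, Finset.card_univ, Fintype.card_fin] at hsum
    rw [A.encard_colBases, Nat.cast_inj]
    omega
  constructor
  · rintro ⟨A, hA⟩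
    exact ⟨_, by simp, (key A).1 hA⟩
  · rintro ⟨S, hn, hS⟩
    obtain ⟨v, rfl⟩ : ∃ v : Fin n → Fin r → ℚ, Finset.univ.val.map v = S := by
      obtain ⟨l, rfl⟩ := Quot.exists_rep S
      change l.length = n at hn
      subst hn
      exact ⟨l.get, by rw [Fin.univ_val_map, List.ofFn_get]; rfl⟩
    exact ⟨Matrix.of fun i j => v j i, (key _).2 hS⟩

/-! ### Generic extensions -/

section Generic

variable {V : Type*} [AddCommGroup V] [Module ℚ V]

/-- A generic vector of `W` avoids every subspace of a finite family that does not contain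
`W`. -/
lemma Submodule.exists_generic (W : Submodule ℚ V) (F : Finset (Submodule ℚ V)) :
    ∃ w ∈ W, ∀ U ∈ F, w ∈ U → W ≤ U := by
  classical
  let G : Finset (Subspace ℚ W) := (F.image fun U => U.comap W.subtype).filter (· ≠ ⊤)
  have hG : ⊤ ∉ G := by simp [G]
  obtain ⟨w, hw⟩ := (Set.ne_univ_iff_exists_notMem _).1
    (Subspace.biUnion_ne_univ_of_top_notMem hG)
  refine ⟨w, w.2, fun U hU hwU => ?_⟩
  by_contra hWU
  refine hw (Set.mem_iUnion₂.2 ⟨U.comap W.subtype, ?_, hwU⟩)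
  simp only [G, Finset.mem_filter, Finset.mem_image]
  exact ⟨⟨U, hU, rfl⟩, fun h => hWU (Submodule.comap_subtype_eq_top.1 h)⟩

lemma Multiset.exists_generic (W : Submodule ℚ V) (S : Multiset V) :
    ∃ w ∈ W, ∀ T ≤ S, w ∈ Submodule.span ℚ {x | x ∈ T} → W ≤ Submodule.span ℚ {x | x ∈ T} := by
  classical
  obtain ⟨w, hw, h⟩ := W.exists_generic
    (S.powerset.toFinset.image fun T => Submodule.span ℚ {x | x ∈ T})
  refine ⟨w, hw, fun T hT => h _ (Finset.mem_image.2 ⟨T, ?_, rfl⟩)⟩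
  simpa using hT

lemma Multiset.countP_powersetCard_one {α : Type*} (p : Multiset α → Prop) [DecidablePred p]
    (S : Multiset α) :
    (S.powersetCard 1).countP p = S.countP fun x => p {x} := by
  rw [Multiset.powersetCard_one, Multiset.countP_map, ← Multiset.countP_eq_card_filter]

open Classical in
lemma Multiset.countP_forall_powersetCard {α : Type*} (p : α → Prop) (k : ℕ) (S : Multiset α) :
    (S.powersetCard k).countP (fun T => ∀ x ∈ T, p x) = (S.countP p).choose k := by
  induction S using Multiset.induction generalizing k with
  | empty =>
    cases k with
    | zero => rw [Multiset.powersetCard_zero_left, Multiset.countP_eq_card.2 (by simp)]; simp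
    | succ k => simp [Multiset.powersetCard_zero_right]
  | cons a S ih =>
    cases k with
    | zero => rw [Multiset.powersetCard_zero_left, Multiset.countP_eq_card.2 (by simp)]; simp
    | succ k =>
      rw [Multiset.powersetCard_cons, Multiset.countP_add, ih, Multiset.countP_map,
        ← Multiset.countP_eq_card_filter]
      by_cases ha : p a
      · simp [ha, ih, Nat.choose_succ_succ', add_comm]
      · simp [ha]

lemma Multiset.linIndep_of_numDep_eq_zero {k : ℕ} {S T : Multiset V} (h : S.numDep k = 0)
    (hT : T ≤ S) (hk : T.card = k) : T.LinIndep := by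
  classical
  by_contra hcon
  exact Multiset.countP_eq_zero.1 h T (Multiset.mem_powersetCard.2 ⟨hT, hk⟩) hcon

variable [FiniteDimensional ℚ V]

/-- A generic vector of the whole space lies in no span of fewer vectors of `S` than the
dimension. -/
lemma Multiset.exists_notMem_span (S : Multiset V) :
    ∃ w : V, ∀ T ≤ S, T.card < finrank ℚ V → w ∉ Submodule.span ℚ {x | x ∈ T} := by
  obtain ⟨w, -, h⟩ := Multiset.exists_generic ⊤ S
  refine ⟨w, fun T hT hc hw => ?_⟩
  have h1 := Submodule.finrank_mono (h T hT hw)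
  have h2 := T.finrank_span_le_card
  rw [finrank_top] at h1
  omega

lemma Multiset.not_linIndep_cons_self (e : V) (T : Multiset V) :
    ¬ (e ::ₘ e ::ₘ T).LinIndep := by
  intro h
  exact (Multiset.linIndep_cons.1 h).2 (Submodule.subset_span (by simp))

lemma Multiset.numDep_two_replicate_add {S : Multiset V} {e : V} (hS : (0 : V) ∉ S)
    (heS : ∀ x ∈ S, e ∉ Submodule.span ℚ {x}) (m : ℕ) :
    (Multiset.replicate m e + S).numDep 2 = S.numDep 2 + m.choose 2 := by
  classical
  induction m with
  | zero => simp
  | succ m ih =>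
    rw [Multiset.replicate_succ, Multiset.cons_add, Multiset.numDep_cons, ih,
      Multiset.countP_powersetCard_one, Multiset.countP_add, Multiset.countP_eq_card.2,
      Multiset.countP_eq_zero.2, Multiset.card_replicate, Nat.choose_succ_succ' m 1,
      Nat.choose_one_right]
    · ring
    · intro x hx
      rw [not_not]
      exact Multiset.linIndep_pair.2 ⟨fun h => hS (h ▸ hx), heS x hx⟩
    · intro x hx
      rw [Multiset.eq_of_mem_replicate hx]
      exact Multiset.not_linIndep_cons_self e 0

lemma Multiset.numDep_three_replicate_add {S : Multiset V} {e : V}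
    (heS : ∀ T ≤ S, T.card = 2 → e ∉ Submodule.span ℚ {x | x ∈ T}) (m : ℕ) :
    (Multiset.replicate m e + S).numDep 3 =
      S.numDep 3 + m * S.numDep 2 + m.choose 2 * S.card + m.choose 3 := by
  classical
  -- a pair is dependent together with `e` if it meets the parallel class or is itself dependent
  have hpair : ∀ m : ℕ, ((Multiset.replicate m e + S).powersetCard 2).countP
      (fun T => ¬ (e ::ₘ T).LinIndep) = S.numDep 2 + m * S.card + m.choose 2 := by
    intro m
    induction m with
    | zero =>
      simp only [Multiset.replicate_zero, zero_add, zero_mul, Nat.choose_zero_succ, add_zero]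
      refine Multiset.countP_congr rfl fun T hT => ?_
      rw [Multiset.mem_powersetCard] at hT
      rw [Multiset.linIndep_cons]
      simp [heS T hT.1 hT.2]
    | succ m ih =>
      rw [Multiset.replicate_succ, Multiset.cons_add, Multiset.powersetCard_cons,
        Multiset.countP_add, ih, Multiset.countP_map, Multiset.filter_eq_self.2,
        Multiset.card_powersetCard, Multiset.card_add, Multiset.card_replicate,
        Nat.choose_succ_succ' m 1, Nat.choose_one_right, Nat.choose_one_right]
      · ring
      · exact fun T _ => Multiset.not_linIndep_cons_self e T
  induction m with
  | zero => simp
  | succ m ih =>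
    rw [Multiset.replicate_succ, Multiset.cons_add, Multiset.numDep_cons, ih, hpair,
      Nat.choose_succ_succ' m 1, Nat.choose_succ_succ' m 2, Nat.choose_one_right]
    ring

open Classical in
/-- Adding a generic vector of a plane `W` to a simple configuration keeps it simple, and the
new dependent triples come from the pairs that span `W`. -/
lemma Multiset.exists_cons_mem_plane {S : Multiset V} (hS0 : (0 : V) ∉ S) (hS : S.numDep 2 = 0)
    {W : Submodule ℚ V} (hW : finrank ℚ W = 2) :
    ∃ w ∈ W, w ≠ 0 ∧ (w ::ₘ S).numDep 2 = 0 ∧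
      (w ::ₘ S).numDep 3 = S.numDep 3 + (S.countP (· ∈ W)).choose 2 := by
  obtain ⟨w, hwW, hw⟩ := Multiset.exists_generic W S
  have hline : ∀ T ≤ S, T.card < 2 → w ∉ Submodule.span ℚ {x | x ∈ T} := by
    intro T hT hc h
    have h1 := Submodule.finrank_mono (hw T hT h)
    have h2 := T.finrank_span_le_card
    omega
  refine ⟨w, hwW, ?_, ?_, ?_⟩
  · rintro rfl
    exact hline 0 (Multiset.zero_le _) (by simp) (Submodule.zero_mem _)
  · rw [Multiset.numDep_cons, hS, Multiset.countP_powersetCard_one, zero_add,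
      Multiset.countP_eq_zero]
    intro x hx
    rw [not_not]
    refine Multiset.linIndep_pair.2 ⟨fun h => hS0 (h ▸ hx), fun h => ?_⟩
    refine hline {x} (Multiset.singleton_le.2 hx) (by simp) ?_
    simpa using h
  · rw [Multiset.numDep_cons, ← Multiset.countP_forall_powersetCard]
    congr 1
    refine Multiset.countP_congr rfl fun T hT => ?_
    rw [Multiset.mem_powersetCard] at hT
    have hTi := Multiset.linIndep_of_numDep_eq_zero hS hT.1 hT.2
    rw [Multiset.linIndep_cons, eq_iff_iff]
    simp only [hTi, true_and, not_not]
    constructor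
    · intro h x hx
      have hle := hw T hT.1 h
      have heq := Submodule.eq_of_le_of_finrank_eq hle (by rw [hW, hTi, hT.2])
      rw [heq]
      exact Submodule.subset_span hx
    · intro h
      have hle : Submodule.span ℚ {x | x ∈ T} ≤ W := Submodule.span_le.2 h
      have heq := Submodule.eq_of_le_of_finrank_eq hle (by rw [hW, hTi, hT.2])
      rwa [heq]

end Generic

/-- There is a loopless configuration of `n` vectors in `ℚ^3` with `c` dependent triples and `d`
dependent pairs. It is simple when `d = 0`. -/
def IsConfig (n c d : ℕ) : Prop :=
  ∃ S : Multiset (Fin 3 → ℚ), S.card = n ∧ (0 : Fin 3 → ℚ) ∉ S ∧ S.numDep 2 = d ∧ S.numDep 3 = c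

lemma isConfig_zero : IsConfig 0 0 0 :=
  ⟨0, by simp, by simp, by simp [Multiset.numDep, Multiset.powersetCard_zero_right],
    by simp [Multiset.numDep, Multiset.powersetCard_zero_right]⟩

/-- Dependent pairs after adding a generic parallel class, in dimension at least two. -/
lemma exists_numDep_two_add {r n d : ℕ} (hr : 2 ≤ r) (m : ℕ)
    (h : ∃ S : Multiset (Fin r → ℚ), S.card = n ∧ (0 : Fin r → ℚ) ∉ S ∧ S.numDep 2 = d) :
    ∃ S : Multiset (Fin r → ℚ), S.card = n + m ∧ (0 : Fin r → ℚ) ∉ S ∧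
      S.numDep 2 = d + m.choose 2 := by
  obtain ⟨S, hn, h0, hd⟩ := h
  obtain ⟨e, he⟩ := S.exists_notMem_span
  rw [finrank_fin_fun] at he
  have he0 : e ≠ 0 := by
    rintro rfl
    exact he 0 (Multiset.zero_le _) (by simp; omega) (Submodule.zero_mem _)
  refine ⟨Multiset.replicate m e + S, by simp [hn, add_comm], ?_, ?_⟩
  · rw [Multiset.mem_add, Multiset.mem_replicate]
    rintro (⟨-, h⟩ | h)
    · exact he0 h.symm
    · exact h0 h
  · rw [Multiset.numDep_two_replicate_add h0, hd]
    intro x hx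
    simpa using he {x} (Multiset.singleton_le.2 hx) (by rw [Multiset.card_singleton]; omega)

/-- Adding a generic parallel class of `m` elements. -/
lemma IsConfig.addClass {n c d : ℕ} (m : ℕ) (h : IsConfig n c d) :
    IsConfig (n + m) (c + m * d + m.choose 2 * n + m.choose 3) (d + m.choose 2) := by
  obtain ⟨S, hn, h0, hd, hc⟩ := h
  obtain ⟨e, he⟩ := S.exists_notMem_span
  rw [finrank_fin_fun] at he
  have he0 : e ≠ 0 := by
    rintro rfl
    exact he 0 (Multiset.zero_le _) (by simp) (Submodule.zero_mem _)
  refine ⟨Multiset.replicate m e + S, by simp [hn, add_comm], ?_, ?_, ?_⟩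
  · rw [Multiset.mem_add, Multiset.mem_replicate]
    rintro (⟨-, h⟩ | h)
    · exact he0 h.symm
    · exact h0 h
  · rw [Multiset.numDep_two_replicate_add h0, hd]
    intro x hx
    simpa using he {x} (Multiset.singleton_le.2 hx) (by simp)
  · rw [Multiset.numDep_three_replicate_add, hd, hc, hn]
    exact fun T hT h2 => he T hT (by omega)

lemma IsConfig.mono {n n' c : ℕ} (h : IsConfig n c 0) (hn : n ≤ n') : IsConfig n' c 0 := by
  induction n', hn using Nat.le_induction with
  | base => exact h
  | succ m _ ih => simpa [Nat.choose_eq_zero_of_lt] using ih.addClass 1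

open Classical in
/-- There is a simple configuration of `n` vectors with `c` dependent triples, exactly `k` of
whose vectors lie on some common plane (a line of the projective plane). -/
def IsLineConfig (n c k : ℕ) : Prop :=
  ∃ S : Multiset (Fin 3 → ℚ), S.card = n ∧ (0 : Fin 3 → ℚ) ∉ S ∧ S.numDep 2 = 0 ∧
    S.numDep 3 = c ∧ ∃ W : Submodule ℚ (Fin 3 → ℚ), finrank ℚ W = 2 ∧ S.countP (· ∈ W) = k

lemma IsLineConfig.addPoint {n c k : ℕ} (h : IsLineConfig n c k) :
    IsLineConfig (n + 1) (c + k.choose 2) (k + 1) := by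
  obtain ⟨S, hn, h0, hd, hc, W, hW, hk⟩ := h
  obtain ⟨w, hwW, hw0, h2, h3⟩ := Multiset.exists_cons_mem_plane h0 hd hW
  refine ⟨w ::ₘ S, by simp [hn], ?_, h2, by rw [h3, hc, hk], W, hW, by simp [hwW, hk]⟩
  rw [Multiset.mem_cons]
  exact fun h => h.elim (fun h => hw0 h.symm) h0

/-- A generic new point spans an ordinary line with any given old point. -/
lemma IsConfig.isLineConfig_two {n c : ℕ} (hn : 1 ≤ n) (h : IsConfig n c 0) :
    IsLineConfig (n + 1) c 2 := by
  classical
  obtain ⟨S, hcard, h0, hd, hc⟩ := h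
  obtain ⟨e, he⟩ := S.exists_notMem_span
  rw [finrank_fin_fun] at he
  have he0 : e ≠ 0 := by
    rintro rfl
    exact he 0 (Multiset.zero_le _) (by simp) (Submodule.zero_mem _)
  have heS : ∀ x ∈ S, e ∉ Submodule.span ℚ {x} := fun x hx => by
    simpa using he {x} (Multiset.singleton_le.2 hx) (by simp)
  obtain ⟨p, hp⟩ := Multiset.card_pos_iff_exists_mem.1 (show 0 < S.card by omega)
  have h2 := Multiset.numDep_two_replicate_add h0 heS 1
  have h3 := Multiset.numDep_three_replicate_add (S := S) (e := e)
    (fun T hT h2 => he T hT (by omega)) 1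
  simp only [Multiset.replicate_one, Multiset.singleton_add, hd, hc] at h2 h3
  refine ⟨e ::ₘ S, by simp [hcard], ?_, by simpa using h2,
    by simpa [Nat.choose_eq_zero_of_lt] using h3,
    Submodule.span ℚ {x | x ∈ ({e, p} : Multiset (Fin 3 → ℚ))}, ?_, ?_⟩
  · rw [Multiset.mem_cons]
    exact fun h => h.elim (fun h => he0 h.symm) h0
  · exact Multiset.linIndep_pair.2 ⟨fun h => h0 (h ▸ hp), heS p hp⟩
  · have hset : {x | x ∈ ({e, p} : Multiset (Fin 3 → ℚ))} = {e, p} := by ext; simp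
    rw [hset]
    obtain ⟨S', rfl⟩ := Multiset.exists_cons_of_mem hp
    have he' : e ∈ Submodule.span ℚ {e, p} := Submodule.subset_span (by simp)
    have hp' : p ∈ Submodule.span ℚ {e, p} := Submodule.subset_span (by simp)
    rw [Multiset.countP_cons_of_pos _ he', Multiset.countP_cons_of_pos _ hp',
      Multiset.countP_eq_zero.2]
    intro x hx hxe
    have hle : ({x, p} : Multiset (Fin 3 → ℚ)) ≤ p ::ₘ S' := by
      rw [Multiset.pair_comm]
      exact Multiset.cons_le_cons p (Multiset.singleton_le.2 hx)
    have hxp := (Multiset.linIndep_pair.1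
      (Multiset.linIndep_of_numDep_eq_zero hd hle (by simp))).2
    have hset' : {y | y ∈ ({x, p} : Multiset (Fin 3 → ℚ))} = {x, p} := by ext; simp
    refine he _ hle (by simp) ?_
    rw [hset']
    exact mem_span_insert_exchange hxe hxp

/-- Adding a line of `k + 2` points through an old point and otherwise generic. -/
lemma IsConfig.addLine {n c : ℕ} (k : ℕ) (hn : 1 ≤ n) (h : IsConfig n c 0) :
    IsConfig (n + (k + 1)) (c + (k + 2).choose 3) 0 := by
  have key : IsLineConfig (n + (k + 1)) (c + (k + 2).choose 3) (k + 2) := by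
    induction k with
    | zero => simpa using h.isLineConfig_two hn
    | succ k ih =>
      have := ih.addPoint
      rw [show k + 1 + 2 = k + 2 + 1 from rfl, Nat.choose_succ_succ' (k + 2) 2,
        add_comm (Nat.choose _ 2), ← add_assoc c]
      exact this
  obtain ⟨S, h1, h2, h3, h4, -⟩ := key
  exact ⟨S, h1, h2, h3, h4⟩

/-! ### Explicit integer configurations -/

/-- The determinant of three vectors of `ℤ^3`. -/
def tripleDet (x y z : ℤ × ℤ × ℤ) : ℤ :=
  x.1 * (y.2.1 * z.2.2 - y.2.2 * z.2.1) - x.2.1 * (y.1 * z.2.2 - y.2.2 * z.1) +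
    x.2.2 * (y.1 * z.2.1 - y.2.1 * z.1)

/-- An integer vector viewed in `ℚ^3`. -/
def ratVec (x : ℤ × ℤ × ℤ) : Fin 3 → ℚ := ![(x.1 : ℚ), x.2.1, x.2.2]

/-- The number of pairs in a list that are linearly dependent together with `x`. -/
def coplanarPairs (x : ℤ × ℤ × ℤ) : List (ℤ × ℤ × ℤ) → ℕ
  | [] => 0
  | y :: l => coplanarPairs x l + l.countP fun z => tripleDet x y z == 0

/-- The number of linearly dependent triples in a list. -/
def coplanarTriples : List (ℤ × ℤ × ℤ) → ℕ
  | [] => 0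
  | x :: l => coplanarTriples l + coplanarPairs x l

lemma linIndep_ratVec_iff (x y z : ℤ × ℤ × ℤ) :
    ({ratVec x, ratVec y, ratVec z} : Multiset (Fin 3 → ℚ)).LinIndep ↔ tripleDet x y z ≠ 0 := by
  let M : Matrix (Fin 3) (Fin 3) ℚ := Matrix.of ![ratVec x, ratVec y, ratVec z]
  have hdet : M.det = tripleDet x y z := by
    rw [Matrix.det_fin_three]
    simp [M, ratVec, tripleDet]
    ring
  have h1 := Multiset.linIndep_map_val_iff M.row (Finset.univ : Finset (Fin 3))
  have h2 : (Finset.univ : Finset (Fin 3)).val.map M.row =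
      ({ratVec x, ratVec y, ratVec z} : Multiset (Fin 3 → ℚ)) := by
    rw [Fin.univ_val_map]
    rfl
  rw [h2, Finset.coe_univ, linearIndepOn_univ_iff] at h1
  rw [h1, Matrix.linearIndependent_rows_iff_isUnit, Matrix.isUnit_iff_isUnit_det, hdet,
    isUnit_iff_ne_zero]
  exact_mod_cast Iff.rfl

lemma numDep_three_ratVec (l : List (ℤ × ℤ × ℤ)) :
    Multiset.numDep 3 (Multiset.map ratVec l) = coplanarTriples l := by
  classical
  have hpairs : ∀ (x : ℤ × ℤ × ℤ) (l : List (ℤ × ℤ × ℤ)),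
      ((Multiset.map ratVec l).powersetCard 2).countP (fun T => ¬ (ratVec x ::ₘ T).LinIndep) =
        coplanarPairs x l := by
    intro x l
    induction l with
    | nil => simp [coplanarPairs, Multiset.powersetCard_zero_right]
    | cons y l ih =>
      rw [← Multiset.cons_coe, Multiset.map_cons, Multiset.powersetCard_cons, Multiset.countP_add,
        ih, Multiset.countP_map, ← Multiset.countP_eq_card_filter,
        Multiset.countP_powersetCard_one, Multiset.countP_map, ← Multiset.countP_eq_card_filter,
        coplanarPairs, Multiset.coe_countP]
      congr 1
      refine List.countP_congr fun z _ => ?_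
      have := linIndep_ratVec_iff x y z
      simp only [Multiset.insert_eq_cons] at this
      simp [this]
  induction l with
  | nil => simp [coplanarTriples, Multiset.numDep, Multiset.powersetCard_zero_right]
  | cons x l ih =>
    rw [← Multiset.cons_coe, Multiset.map_cons, Multiset.numDep_cons, ih, hpairs, coplanarTriples]

/-- Two integer vectors are not proportional: some coordinate vector completes them to a basis. -/
def notProportional (x y : ℤ × ℤ × ℤ) : Bool :=
  tripleDet x y (1, 0, 0) != 0 || tripleDet x y (0, 1, 0) != 0 || tripleDet x y (0, 0, 1) != 0

/-- The vectors of the list are nonzero and pairwise not proportional. -/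
def isSimpleList : List (ℤ × ℤ × ℤ) → Bool
  | [] => true
  | x :: l => isSimpleList l && x != (0, 0, 0) && l.all (notProportional x)

lemma linIndep_pair_of_notProportional {x y : ℤ × ℤ × ℤ} (h : notProportional x y = true) :
    ({ratVec x, ratVec y} : Multiset (Fin 3 → ℚ)).LinIndep := by
  have key : ∀ z, tripleDet x y z ≠ 0 →
      ({ratVec x, ratVec y} : Multiset (Fin 3 → ℚ)).LinIndep := by
    intro z hz
    refine ((linIndep_ratVec_iff x y z).2 hz).of_le ?_
    simp only [Multiset.insert_eq_cons]
    exact Multiset.cons_le_cons _ (Multiset.cons_le_cons _ (Multiset.zero_le _))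
  simp only [notProportional, Bool.or_eq_true, bne_iff_ne] at h
  rcases h with (h | h) | h <;> exact key _ h

lemma isConfig_of_list {l : List (ℤ × ℤ × ℤ)} (h : isSimpleList l = true) :
    IsConfig l.length (coplanarTriples l) 0 := by
  classical
  refine ⟨Multiset.map ratVec l, by simp, ?_, ?_, numDep_three_ratVec l⟩
  · induction l with
    | nil => simp
    | cons x l ih =>
      simp only [isSimpleList, Bool.and_eq_true, bne_iff_ne] at h
      rw [← Multiset.cons_coe, Multiset.map_cons, Multiset.mem_cons]
      rintro (h0 | h0)
      · refine h.1.2 ?_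
        have h1 := congrFun h0 0
        have h2 := congrFun h0 1
        have h3 := congrFun h0 2
        simp only [ratVec, Pi.zero_apply, Matrix.cons_val] at h1 h2 h3
        refine Prod.ext ?_ (Prod.ext ?_ ?_)
        · exact_mod_cast h1.symm
        · exact_mod_cast h2.symm
        · exact_mod_cast h3.symm
      · exact ih h.1.1 h0
  · induction l with
    | nil => simp [Multiset.numDep, Multiset.powersetCard_zero_right]
    | cons x l ih =>
      simp only [isSimpleList, Bool.and_eq_true, List.all_eq_true] at h
      rw [← Multiset.cons_coe, Multiset.map_cons, Multiset.numDep_cons, ih h.1.1,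
        Multiset.countP_powersetCard_one, zero_add, Multiset.countP_eq_zero]
      intro v hv
      obtain ⟨y, hy, rfl⟩ := Multiset.mem_map.1 hv
      rw [not_not]
      exact linIndep_pair_of_notProportional (h.2 y hy)

/-! ### Searching for small configurations -/

/-- Sizes `n` and numbers `c` of dependent triples of the simple configurations from which the
search builds all others. -/
def seedSizes : List (ℕ × ℕ) :=
  [(5, 2), (6, 3), (6, 5), (8, 13), (10, 27), (11, 32), (11, 41), (11, 42), (12, 47), (12, 49)]

lemma isConfig_of_mem_seedSizes {n c : ℕ} (h : (n, c) ∈ seedSizes) : IsConfig n c 0 := by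
  have key : ∀ l : List (ℤ × ℤ × ℤ),
      (isSimpleList l && l.length == n && coplanarTriples l == c) = true → IsConfig n c 0 := by
    intro l hl
    simp only [Bool.and_eq_true, beq_iff_eq] at hl
    obtain ⟨⟨h1, rfl⟩, rfl⟩ := hl
    exact isConfig_of_list h1
  simp only [seedSizes, List.mem_cons, Prod.mk.injEq, List.not_mem_nil, or_false] at h
  rcases h with ⟨rfl, rfl⟩ | ⟨rfl, rfl⟩ | ⟨rfl, rfl⟩ | ⟨rfl, rfl⟩ | ⟨rfl, rfl⟩ | ⟨rfl, rfl⟩ |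
    ⟨rfl, rfl⟩ | ⟨rfl, rfl⟩ | ⟨rfl, rfl⟩ | ⟨rfl, rfl⟩
  · exact key [(1, 0, 0), (0, 1, 0), (0, 0, 1), (1, 1, 1), (1, 1, 0)] (by decide +kernel)
  · exact key [(1, 0, 0), (0, 1, 0), (0, 0, 1), (1, 1, 1), (1, 1, 0), (1, 0, -2)]
      (by decide +kernel)
  · exact key [(1, 0, 0), (0, 1, 0), (0, 0, 1), (1, 1, 1), (1, 1, 0), (2, 2, -5)]
      (by decide +kernel)
  · exact key [(1, 0, 0), (0, 1, 0), (0, 0, 1), (1, 1, 1), (3, 0, -2), (1, 0, -1), (1, 0, 1),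
      (2, 1, 0)] (by decide +kernel)
  · exact key [(1, 0, 0), (0, 1, 0), (0, 0, 1), (1, 1, 1), (1, 0, -1), (1, 0, 2), (2, 0, 1),
      (0, 2, 1), (1, 0, 1), (0, 1, -1)] (by decide +kernel)
  · exact key [(1, 0, 0), (0, 1, 0), (0, 0, 1), (1, 1, 1), (2, 0, 1), (1, 0, 1), (3, 0, 2),
      (2, -1, 2), (1, 1, -1), (1, -1, 1), (1, 3, 1)] (by decide +kernel)
  · exact key [(1, 0, 0), (0, 1, 0), (0, 0, 1), (1, 1, 1), (1, 0, 1), (1, 1, 0), (1, -1, -1),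
      (2, -1, 0), (1, -1, 0), (1, -2, 0), (3, 2, 0)] (by decide +kernel)
  · exact key [(1, 0, 0), (0, 1, 0), (0, 0, 1), (1, 1, 1), (1, 0, 1), (3, 0, 2), (1, 1, 0),
      (2, -1, 2), (2, 1, 2), (1, -6, 1), (2, 5, 2)] (by decide +kernel)
  · exact key [(1, 0, 0), (0, 1, 0), (0, 0, 1), (1, 1, 1), (1, 0, 1), (1, 0, -1), (3, 0, -2),
      (1, 4, 1), (2, 0, -1), (3, 0, 1), (4, 5, 6), (7, 5, 7)] (by decide +kernel)
  · exact key [(1, 0, 0), (0, 1, 0), (0, 0, 1), (1, 1, 1), (1, -1, 0), (3, -1, 0), (2, -2, -1),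
      (1, 3, 0), (1, -1, -1), (1, 1, 0), (3, 2, 0), (1, -1, 1)] (by decide +kernel)

/-- The value `f n`, with `n` evaluated first: this keeps kernel computations from carrying
unevaluated arguments. -/
def evalFirst (n : ℕ) (f : ℕ → Bool) : Bool :=
  match n with
  | 0 => f 0
  | k + 1 => f (Nat.succ k)

lemma evalFirst_eq (n : ℕ) (f : ℕ → Bool) : evalFirst n f = f n := by
  cases n <;> rfl

/-- The pairs `(k, k.choose 3)` for the sizes `k` of lines used in the search. -/
def lineSizes : List (ℕ × ℕ) :=
  [(19, 969), (18, 816), (17, 680), (16, 560), (15, 455), (14, 364), (13, 286), (12, 220),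
    (11, 165), (10, 120), (9, 84), (8, 56), (7, 35), (6, 20), (5, 10), (4, 4), (3, 1)]

/-- Whether some line reduces `(n, c)` to a pair accepted by `s`. -/
def removeLine (s : ℕ → ℕ → Bool) (n c : ℕ) : Bool :=
  lineSizes.any fun p => Nat.ble p.2 c && (Nat.ble p.1 n &&
    evalFirst (n + 1 - p.1) fun n' => evalFirst (c - p.2) fun c' => s n' c')

/-- Whether a simple configuration of `n` vectors with `c` dependent triples arises from a seed,
or from independent vectors, by adding generic vectors and at most `fuel` lines. -/
def lineSearch : ℕ → ℕ → ℕ → Bool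
  | 0, n, c => Nat.beq c 0 || seedSizes.any fun p => Nat.beq p.2 c && Nat.ble p.1 n
  | fuel + 1, n, c => Nat.beq c 0 || (seedSizes.any fun p => Nat.beq p.2 c && Nat.ble p.1 n) ||
      removeLine (lineSearch fuel) n c

lemma isConfig_of_removeLine {s : ℕ → ℕ → Bool}
    (hs : ∀ n c, s n c = true → IsConfig n c 0) {n c : ℕ} (h : removeLine s n c = true) :
    IsConfig n c 0 := by
  simp only [removeLine, List.any_eq_true, Bool.and_eq_true, Nat.ble_eq, evalFirst_eq] at h
  obtain ⟨⟨k, t⟩, hp, h1, h2, h3⟩ := h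
  have htable : ∀ p ∈ lineSizes, 3 ≤ p.1 ∧ p.1.choose 3 = p.2 := by decide
  obtain ⟨hk, ht⟩ := htable _ hp
  obtain ⟨k, rfl⟩ := Nat.exists_eq_add_of_le' hk
  dsimp only at *
  have := (hs _ _ h3).addLine (k + 1) (by omega)
  rw [show k + 1 + 2 = k + 3 from rfl, ht] at this
  convert this using 1 <;> omega

lemma isConfig_of_seed {n c : ℕ}
    (h : (Nat.beq c 0 || seedSizes.any fun p => Nat.beq p.2 c && Nat.ble p.1 n) = true) :
    IsConfig n c 0 := by
  simp only [Bool.or_eq_true, Nat.beq_eq, List.any_eq_true, Bool.and_eq_true,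
    Nat.ble_eq] at h
  rcases h with rfl | ⟨⟨m, d⟩, hp, rfl, hm⟩
  · exact isConfig_zero.mono (Nat.zero_le n)
  · exact (isConfig_of_mem_seedSizes hp).mono hm

lemma isConfig_of_lineSearch (fuel : ℕ) {n c : ℕ} (h : lineSearch fuel n c = true) :
    IsConfig n c 0 := by
  induction fuel generalizing n c with
  | zero => exact isConfig_of_seed h
  | succ fuel ih =>
    rw [lineSearch, Bool.or_eq_true] at h
    exact h.elim isConfig_of_seed fun h => isConfig_of_removeLine (fun _ _ => ih) h

/-- The number of dependent triples created by adding to `n` vectors with `d` dependent pairs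
generic parallel classes of the given sizes. -/
def classCost : ℕ → ℕ → List ℕ → ℕ
  | _, _, [] => 0
  | n, d, m :: ms => m * d + m * (m - 1) / 2 * n + m.choose 3 +
      classCost (n + m) (d + m * (m - 1) / 2) ms

lemma IsConfig.addClasses (ms : List ℕ) {n c d : ℕ} (h : IsConfig n c d) :
    ∃ d', IsConfig (n + ms.sum) (c + classCost n d ms) d' := by
  induction ms generalizing n c d with
  | nil => exact ⟨d, by simpa [classCost] using h⟩
  | cons m ms ih =>
    obtain ⟨d', hd'⟩ := ih (h.addClass m)
    refine ⟨d', ?_⟩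
    rw [Nat.choose_two_right] at hd'
    rw [List.sum_cons, classCost]
    convert hd' using 1 <;> ring

/-- Whether `lineSearch` succeeds after removing parallel classes: fewer than `a` pairs and classes
of the sizes in `t`. -/
def removeClasses (n c : ℕ) (t : List ℕ) : ℕ → Bool
  | 0 => false
  | a + 1 => (Nat.ble (2 * a + t.sum) n && evalFirst (n - (2 * a + t.sum)) fun n' =>
      evalFirst (classCost n' 0 (List.replicate a 2 ++ t)) fun k =>
        Nat.ble k c && evalFirst (c - k) fun c' => lineSearch 2 n' c') ||
      removeClasses n c t a

lemma isConfig_of_removeClasses {n c a : ℕ} {t : List ℕ} (h : removeClasses n c t a = true) :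
    ∃ d, IsConfig n c d := by
  induction a with
  | zero => simp [removeClasses] at h
  | succ a ih =>
    simp only [removeClasses, Bool.or_eq_true, Bool.and_eq_true, Nat.ble_eq, evalFirst_eq] at h
    rcases h with ⟨h1, h2, h3⟩ | h
    · obtain ⟨d, hd⟩ := (isConfig_of_lineSearch 2 h3).addClasses (List.replicate a 2 ++ t)
      refine ⟨d, ?_⟩
      convert hd using 1
      · simp only [List.sum_append, List.sum_replicate, smul_eq_mul]
        omega
      · omega
    · exact ih h

/-- The pairs `(n, c)` with `n ≤ 29` and `c < (n - 1).choose 2` not reached by the search. -/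
def sporadicSizes : List (ℕ × ℕ) :=
  [(5, 5), (6, 6), (6, 7), (6, 9), (7, 12), (8, 15), (8, 19), (9, 25), (12, 51)]

/-- Whether `(m, c)` is sporadic or reached by the search for each `n ≤ m < n + k`. A simple
configuration settles all larger sizes at once, as generic vectors may be added to it. -/
def coversRange (c : ℕ) : ℕ → ℕ → Bool
  | 0, _ => true
  | k + 1, n => lineSearch 2 n c ||
      ((sporadicSizes.contains (n, c) || removeClasses n c [3, 3] 12 ||
        removeClasses n c [3] 12 || removeClasses n c [] 12 || removeClasses n c [4] 12) &&
        coversRange c k (n + 1))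

lemma isConfig_of_coversRange {c k n m : ℕ} (h : coversRange c k n = true) (hn : n ≤ m)
    (hm : m < n + k) : (m, c) ∈ sporadicSizes ∨ ∃ d, IsConfig m c d := by
  induction k generalizing n with
  | zero => omega
  | succ k ih =>
    simp only [coversRange, Bool.or_eq_true, Bool.and_eq_true, List.contains_iff_mem] at h
    rcases h with h | ⟨h1, h2⟩
    · exact .inr ⟨0, (isConfig_of_lineSearch 2 h).mono hn⟩
    · rcases hn.eq_or_lt with rfl | hlt
      · rcases h1 with (((h1 | h1) | h1) | h1) | h1
        · exact .inl h1
        all_goals exact .inr (isConfig_of_removeClasses h1)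
      · exact ih h2 hlt (by omega)

/-- At size `n + 3` the range `c < (n + 2).choose 2` first contains the values from
`(n + 1).choose 2` on; these are followed through all sizes up to `29`. -/
lemma coversRange_of_lt {n c : ℕ} (hn : n < 27) (hc : c < n + 1) :
    coversRange ((n + 1) * n / 2 + c) (27 - n) (n + 3) = true := by
  have h : ((List.range 27).all fun n => (List.range (n + 1)).all fun c =>
      coversRange ((n + 1) * n / 2 + c) (27 - n) (n + 3)) = true := by
    decide +kernel
  rw [List.all_eq_true] at h
  have h1 := h n (List.mem_range.2 hn)
  rw [List.all_eq_true] at h1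
  exact h1 c (List.mem_range.2 hc)

/-! ### Rank three -/

lemma lineSearch_thirty {c : ℕ} (hc : c < 406) : lineSearch 3 30 c = true := by
  have h : ((List.range 406).all fun c => lineSearch 3 30 c) = true := by decide +kernel
  rw [List.all_eq_true] at h
  exact h c (List.mem_range.2 hc)

/-- At the sizes from `31` to `44`, simple configurations exist for the values of `c` that are not
already covered at the preceding size. -/
lemma lineSearch_above_thirty {i j : ℕ} (hi : i < 14) (hj : j < i + 29) :
    lineSearch 3 (i + 31) ((i + 29) * (i + 28) / 2 + j) = true := by
  have h : ((List.range 14).all fun i => (List.range (i + 29)).all fun j =>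
      lineSearch 3 (i + 31) ((i + 29) * (i + 28) / 2 + j)) = true := by
    decide +kernel
  rw [List.all_eq_true] at h
  have h1 := h i (List.mem_range.2 hi)
  rw [List.all_eq_true] at h1
  exact h1 j (List.mem_range.2 hj)

lemma six_mul_choose_three (k : ℕ) : 6 * (k + 2).choose 3 = (k + 2) * (k + 1) * k := by
  have := Nat.descFactorial_eq_factorial_mul_choose (k + 2) 3
  simp [Nat.descFactorial_succ, Nat.factorial] at this
  rw [← this]
  ring

/-- For large `n` every `c < (n - 1).choose 2` is the number of dependent triples of a simple
configuration: one line of about `√(6 n)` points brings `c` into the range available on the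
remaining vectors. -/
lemma isConfig_of_large {m c : ℕ} (hm : 28 ≤ m) (hc : 2 * c < (m + 1) * m) :
    IsConfig (m + 2) c 0 := by
  induction m using Nat.strong_induction_on generalizing c with
  | _ m ih =>
  rcases hm.eq_or_lt with rfl | hm'
  · exact isConfig_of_lineSearch 3 (lineSearch_thirty (by omega))
  -- a generic vector does not change `c`, so only the top range of `c` is new
  by_cases hsmall : 2 * c < m * (m - 1)
  · obtain ⟨m, rfl⟩ : ∃ m', m = m' + 1 := ⟨m - 1, by omega⟩
    exact (ih m (by omega) (by omega) hsmall).mono (by omega)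
  by_cases hmid : m < 43
  · obtain ⟨i, rfl⟩ : ∃ i, m = i + 29 := ⟨m - 29, by omega⟩
    have hev : 2 * ((i + 29) * (i + 28) / 2) = (i + 29) * (i + 28) := by
      refine Nat.mul_div_cancel' ?_
      have := Nat.even_mul_succ_self (i + 28)
      rw [mul_comm]
      exact this.two_dvd
    have e1 : (i + 29 + 1) * (i + 29) = (i + 29) * (i + 28) + 2 * (i + 29) := by ring
    have e2 : (i + 29) * (i + 29 - 1) = (i + 29) * (i + 28) := rfl
    have := isConfig_of_lineSearch 3 (lineSearch_above_thirty (i := i)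
      (j := c - (i + 29) * (i + 28) / 2) (by omega) (by omega))
    rwa [Nat.add_sub_cancel' (by omega)] at this
  push Not at hsmall hmid
  -- the least `k` for which the interval of values reached with a `(k + 2)`-point line extends to
  -- the top of the range
  have hex : ∃ k, 6 * (m + 1) ≤ (k + 2) * (k + 3) := ⟨6 * m, by nlinarith⟩
  obtain ⟨k, hk, hmin⟩ : ∃ k, 6 * (m + 1) ≤ (k + 2) * (k + 3) ∧
      (k + 1) * (k + 2) < 6 * (m + 1) := by
    refine ⟨Nat.find hex, Nat.find_spec hex, ?_⟩
    rcases h : Nat.find hex with _ | k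
    · omega
    · have := Nat.find_min hex (m := k) (by omega)
      push Not at this
      exact this
  have hk1 : k + 29 ≤ m := by
    by_contra! hcon
    nlinarith
  have hk2 : 2 * k + 2 ≤ m := by
    by_contra! hcon
    nlinarith
  obtain ⟨m', rfl⟩ : ∃ m', m = m' + (k + 1) := ⟨m - (k + 1), by omega⟩
  have h6 := six_mul_choose_three k
  rw [show m' + (k + 1) - 1 = m' + k by omega] at hsmall
  have hle : (k + 2).choose 3 ≤ c := by
    have : (k + 2) * (k + 1) * k ≤ 3 * ((m' + (k + 1)) * (m' + k)) := by
      have h1 : (k + 2) * (k + 1) * k ≤ (6 * (m' + (k + 1) + 1)) * k := by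
        refine Nat.mul_le_mul_right _ ?_
        rw [mul_comm]
        exact hmin.le
      nlinarith
    omega
  have hlt : 2 * (c - (k + 2).choose 3) < (m' + 1) * m' := by
    have : 3 * ((m' + (k + 1) + 1) * (m' + (k + 1))) ≤
        3 * ((m' + 1) * m') + (k + 2) * (k + 1) * k := by
      have h1 := Nat.mul_le_mul_left (k + 1) hk
      nlinarith
    omega
  have := (ih m' (by omega) (by omega) hlt).addLine k (by omega)
  rw [Nat.sub_add_cancel hle] at this
  convert this using 1
  omega

lemma exists_eq_triangle_add (c : ℕ) : ∃ i j, j < i + 1 ∧ c = (i + 1) * i / 2 + j := by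
  induction c with
  | zero => exact ⟨0, 0, by omega, rfl⟩
  | succ c ih =>
    obtain ⟨i, j, hj, rfl⟩ := ih
    rcases (show j + 1 < i + 1 ∨ j = i by omega) with h | rfl
    · exact ⟨i, j + 1, h, by omega⟩
    · refine ⟨j + 1, 0, by omega, ?_⟩
      have : (j + 1 + 1) * (j + 1) = (j + 1) * j + 2 * (j + 1) := by ring
      omega

lemma exists_numDep_three_of_list (l : List (ℤ × ℤ × ℤ)) :
    ∃ S : Multiset (Fin 3 → ℚ), S.card = l.length ∧ S.numDep 3 = coplanarTriples l :=
  ⟨Multiset.map ratVec l, by simp, numDep_three_ratVec l⟩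

/-- The sporadic pairs other than `(6, 9)` are realized by explicit vectors, some of them
parallel. -/
lemma exists_numDep_three_of_mem_sporadicSizes {n c : ℕ} (h : (n, c) ∈ sporadicSizes)
    (h69 : (n, c) ≠ (6, 9)) :
    ∃ S : Multiset (Fin 3 → ℚ), S.card = n ∧ S.numDep 3 = c := by
  have key : ∀ l : List (ℤ × ℤ × ℤ), (l.length == n && coplanarTriples l == c) = true →
      ∃ S : Multiset (Fin 3 → ℚ), S.card = n ∧ S.numDep 3 = c := by
    intro l hl
    simp only [Bool.and_eq_true, beq_iff_eq] at hl
    obtain ⟨rfl, rfl⟩ := hl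
    exact exists_numDep_three_of_list l
  simp only [sporadicSizes, List.mem_cons, Prod.mk.injEq, List.not_mem_nil, or_false] at h
  rcases h with ⟨rfl, rfl⟩ | ⟨rfl, rfl⟩ | ⟨rfl, rfl⟩ | ⟨rfl, rfl⟩ | ⟨rfl, rfl⟩ | ⟨rfl, rfl⟩ |
    ⟨rfl, rfl⟩ | ⟨rfl, rfl⟩ | ⟨rfl, rfl⟩
  · exact key [(1, 0, 0), (0, 1, 0), (0, 0, 1), (-1, 0, 1), (-1, 0, 0)] (by decide +kernel)
  · exact key [(1, 0, 0), (0, 1, 0), (0, 0, 1), (2, 1, -1), (3, 1, -1), (3, 1, -1)]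
      (by decide +kernel)
  · exact key [(1, 0, 0), (0, 1, 0), (0, 0, 1), (1, 0, 1), (0, 1, 1), (-1, 0, 0)]
      (by decide +kernel)
  · exact absurd rfl h69
  · exact key [(1, 0, 0), (0, 1, 0), (0, 0, 1), (-1, -1, 2), (0, 1, 1), (-1, -1, 2), (0, 0, 1)]
      (by decide +kernel)
  · exact key [(1, 0, 0), (0, 1, 0), (0, 0, 1), (0, 0, 1), (0, 1, 1), (1, 0, 1), (1, -1, -1),
      (1, 1, 1)] (by decide +kernel)
  · exact key [(1, 0, 0), (0, 1, 0), (0, 0, 1), (1, -1, -1), (1, 0, -1), (1, 0, -1), (-1, 1, -1),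
      (1, 0, 0)] (by decide +kernel)
  · exact key [(1, 0, 0), (0, 1, 0), (0, 0, 1), (-1, 1, -1), (-1, 1, -1), (0, 1, -1), (1, 0, 1),
      (1, -1, -1), (0, 1, 0)] (by decide +kernel)
  · exact key [(1, 0, 0), (0, 1, 0), (0, 0, 1), (0, 1, 1), (0, 0, 1), (-1, 1, -1), (1, 0, -1),
      (-1, -1, 1), (-2, 0, 0), (1, -1, -2), (1, 1, -1), (0, 1, -2)] (by decide +kernel)

/-- Every `c < (n - 1).choose 2` other than `9` for `n = 6` is a number of dependent triples. -/
lemma exists_numDep_three {n c : ℕ} (hc : c < (n - 1).choose 2) (h69 : (n, c) ≠ (6, 9)) :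
    ∃ S : Multiset (Fin 3 → ℚ), S.card = n ∧ S.numDep 3 = c := by
  have hc2 : 2 * c < (n - 1) * (n - 1 - 1) := by
    rw [Nat.choose_two_right] at hc
    omega
  have of_config : ∀ {d}, IsConfig n c d →
      ∃ S : Multiset (Fin 3 → ℚ), S.card = n ∧ S.numDep 3 = c := by
    rintro d ⟨S, h1, -, -, h2⟩
    exact ⟨S, h1, h2⟩
  by_cases hn : 30 ≤ n
  · obtain ⟨m, rfl⟩ : ∃ m, n = m + 2 := ⟨n - 2, by omega⟩
    exact of_config (isConfig_of_large (by omega) hc2)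
  · obtain ⟨i, j, hj, rfl⟩ := exists_eq_triangle_add c
    have hin : i + 3 ≤ n := by
      by_contra! hcon
      have h1 : (n - 1) * (n - 1 - 1) ≤ (i + 1) * i := Nat.mul_le_mul (by omega) (by omega)
      have h2 : 2 * ((i + 1) * i / 2) = (i + 1) * i := by
        refine Nat.mul_div_cancel' ?_
        rw [mul_comm]
        exact (Nat.even_mul_succ_self i).two_dvd
      omega
    rcases isConfig_of_coversRange (coversRange_of_lt (n := i) (by omega) hj) hin (by omega) with
      h | ⟨d, h⟩
    · exact exists_numDep_three_of_mem_sporadicSizes h h69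
    · exact of_config h

lemma exists_numDep_three_add {n b : ℕ} (hb : 1 ≤ b) (hbn : b ≤ n.choose 3)
    (h : (n, b) ≠ (6, 11)) :
    ∃ S : Multiset (Fin 3 → ℚ), S.card = n ∧ S.numDep 3 + b = n.choose 3 := by
  induction n with
  | zero => simp at hbn; omega
  | succ n ih =>
    -- the exceptional triple cannot supply the loop extension with `n + 1 = 7`, `b = 11`
    by_cases h7 : (n, b) = (6, 11)
    · obtain ⟨rfl, rfl⟩ := Prod.mk.inj h7
      obtain ⟨S, h1, h2⟩ := exists_numDep_three_of_list
        [(1, 0, 0), (0, 1, 0), (0, 0, 1), (1, 0, 0), (0, 0, 1), (1, 0, -2), (0, 0, -2)]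
      exact ⟨S, h1, by rw [h2]; decide +kernel⟩
    have hpascal : (n + 1).choose 3 = n.choose 2 + n.choose 3 := Nat.choose_succ_succ' n 2
    by_cases hle : b ≤ n.choose 3
    · obtain ⟨S, hS, hd⟩ := ih hle h7
      refine ⟨0 ::ₘ S, by simp [hS], ?_⟩
      have hloop : (0 ::ₘ S).numDep 3 = S.numDep 3 + n.choose 2 :=
        hS ▸ Multiset.numDep_zero_cons 2 S
      omega
    · obtain ⟨S, hS, hd⟩ := exists_numDep_three (n := n + 1) (c := (n + 1).choose 3 - b)
        (by rw [Nat.add_sub_cancel]; omega) (by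
          rintro h69
          obtain ⟨h1, h2⟩ := Prod.mk.inj h69
          obtain rfl : n = 5 := by omega
          simp [Nat.choose] at h2 hbn
          exact h (by simp; omega))
      exact ⟨S, hS, by omega⟩

lemma existsLinearMatroid_three {n b : ℕ} (hb : 1 ≤ b) (hbn : b ≤ n.choose 3)
    (h : (n, b) ≠ (6, 11)) : ExistsLinearMatroid n 3 b := by
  exact (existsLinearMatroid_iff_numDep hb).2 (exists_numDep_three_add hb hbn h)

/-! ### Small rank and small corank -/

/-- In rank two, `c ≤ n - 2` dependent pairs are obtained from parallel classes of sizes three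
and two. -/
lemma exists_numDep_two {n c : ℕ} (hc : c + 2 ≤ n) :
    ∃ S : Multiset (Fin 2 → ℚ), S.card = n ∧ (0 : Fin 2 → ℚ) ∉ S ∧ S.numDep 2 = c := by
  have hzero : ∀ m, ∃ S : Multiset (Fin 2 → ℚ), S.card = m ∧ (0 : Fin 2 → ℚ) ∉ S ∧
      S.numDep 2 = 0 := by
    intro m
    induction m with
    | zero =>
      exact ⟨0, by simp, by simp, by simp [Multiset.numDep, Multiset.powersetCard_zero_right]⟩
    | succ m ih => exact exists_numDep_two_add le_rfl 1 ih
  induction n using Nat.strong_induction_on generalizing c with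
  | _ n ih =>
  rcases (show c = 0 ∨ c = 1 ∨ c = 2 ∨ 3 ≤ c by omega) with rfl | rfl | rfl | h
  · exact hzero n
  · obtain ⟨n, rfl⟩ := Nat.exists_eq_add_of_le' (show 2 ≤ n by omega)
    exact exists_numDep_two_add le_rfl 2 (hzero n)
  · obtain ⟨n, rfl⟩ := Nat.exists_eq_add_of_le' (show 4 ≤ n by omega)
    exact exists_numDep_two_add le_rfl 2 (exists_numDep_two_add le_rfl 2 (hzero n))
  · obtain ⟨n, rfl⟩ := Nat.exists_eq_add_of_le' (show 3 ≤ n by omega)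
    obtain ⟨c, rfl⟩ := Nat.exists_eq_add_of_le' h
    exact exists_numDep_two_add le_rfl 3 (ih n (by omega) (by omega))

lemma existsLinearMatroid_two {n b : ℕ} (hb : 1 ≤ b) (hbn : b ≤ n.choose 2) :
    ExistsLinearMatroid n 2 b := by
  rw [existsLinearMatroid_iff_numDep hb]
  induction n with
  | zero => simp at hbn; omega
  | succ n ih =>
    have hpascal : (n + 1).choose 2 = n + n.choose 2 := by
      rw [Nat.choose_succ_succ' n 1, Nat.choose_one_right]
    by_cases hle : b ≤ n.choose 2
    · obtain ⟨S, hS, hd⟩ := ih hle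
      refine ⟨0 ::ₘ S, by simp [hS], ?_⟩
      have hloop : (0 ::ₘ S).numDep 2 = S.numDep 2 + n.choose 1 :=
        hS ▸ Multiset.numDep_zero_cons 1 S
      rw [Nat.choose_one_right] at hloop
      omega
    · obtain ⟨S, hS, -, hd⟩ := exists_numDep_two (n := n + 1) (c := (n + 1).choose 2 - b) (by omega)
      exact ⟨S, hS, by omega⟩

lemma existsLinearMatroid_one {n b : ℕ} (hb : 1 ≤ b) (hbn : b ≤ n) :
    ExistsLinearMatroid n 1 b := by
  classical
  refine (existsLinearMatroid_iff_numDep hb).2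
    ⟨Multiset.replicate b 1 + Multiset.replicate (n - b) 0, by simp; omega, ?_⟩
  have hone : ¬ ¬ ({1} : Multiset (Fin 1 → ℚ)).LinIndep := by
    rw [not_not]
    exact Multiset.linIndep_singleton.2 one_ne_zero
  have hzero : ¬ ({0} : Multiset (Fin 1 → ℚ)).LinIndep := fun h =>
    Multiset.linIndep_singleton.1 h rfl
  rw [Multiset.numDep, Multiset.countP_powersetCard_one, Multiset.countP_add,
    Multiset.countP_eq_zero.2, Multiset.countP_eq_card.2, Multiset.card_replicate,
    Nat.choose_one_right]
  · omega
  · intro x hx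
    rwa [Multiset.eq_of_mem_replicate hx]
  · intro x hx
    rwa [Multiset.eq_of_mem_replicate hx]

lemma existsLinearMatroid_zero (n : ℕ) : ExistsLinearMatroid n 0 1 := by
  classical
  refine (existsLinearMatroid_iff_numDep le_rfl).2 ⟨Multiset.replicate n 0, by simp, ?_⟩
  rw [Multiset.numDep, Multiset.powersetCard_zero_left, Multiset.countP_eq_zero.2, zero_add,
    Nat.choose_zero_right]
  intro T hT
  rw [Multiset.mem_singleton.1 hT, not_not]
  exact Multiset.linIndep_zero

lemma existsLinearMatroid_of_rank_le_three {n s b : ℕ} (hs : s ≤ 3) (hb : 1 ≤ b)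
    (hbn : b ≤ n.choose s) (h : (n, s, b) ≠ (6, 3, 11)) : ExistsLinearMatroid n s b := by
  interval_cases s
  · rw [Nat.choose_zero_right] at hbn
    obtain rfl : b = 1 := by omega
    exact existsLinearMatroid_zero n
  · exact existsLinearMatroid_one hb (by simpa using hbn)
  · exact existsLinearMatroid_two hb hbn
  · exact existsLinearMatroid_three hb hbn fun h' => h (by simp_all)

/-- Corank at most three: dualize to rank at most three. -/
lemma existsLinearMatroid_of_corank_le_three {n r b : ℕ} (hr : r ≤ n) (hn : n ≤ r + 3)
    (hb : 1 ≤ b) (hbn : b ≤ n.choose r) (h : (n, r, b) ≠ (6, 3, 11)) :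
    ExistsLinearMatroid n r b := by
  refine ExistsLinearMatroid.dual (s := n - r) (by omega) hb
    (existsLinearMatroid_of_rank_le_three (by omega) hb ?_ ?_)
  · rwa [Nat.choose_symm hr]
  · intro h'
    simp only [Prod.mk.injEq] at h'
    exact h (by simp only [Prod.mk.injEq]; omega)

/-- Adding a loop. -/
lemma ExistsLinearMatroid.addLoop {n r b : ℕ} (hb : 1 ≤ b)
    (h : ExistsLinearMatroid n (r + 1) b) : ExistsLinearMatroid (n + 1) (r + 1) b := by
  rw [existsLinearMatroid_iff_numDep hb] at h ⊢
  obtain ⟨S, hS, hd⟩ := h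
  refine ⟨0 ::ₘ S, by simp [hS], ?_⟩
  rw [Multiset.numDep_zero_cons, hS, Nat.choose_succ_succ' n r]
  omega

lemma existsLinearMatroid_of_le_choose {n r b : ℕ} (hb : 1 ≤ b) (hbr : b ≤ (r + 3).choose r)
    (hbn : b ≤ n.choose r) (h : (n, r, b) ≠ (6, 3, 11)) : ExistsLinearMatroid n r b := by
  by_cases hr : r ≤ 3
  · exact existsLinearMatroid_of_rank_le_three hr hb hbn h
  have hrn : r ≤ n := by
    by_contra! hcon
    rw [Nat.choose_eq_zero_of_lt hcon] at hbn
    omega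
  rcases le_total n (r + 3) with hn | hn
  · exact existsLinearMatroid_of_corank_le_three hrn hn hb hbn h
  obtain ⟨r, rfl⟩ : ∃ r', r = r' + 1 := ⟨r - 1, by omega⟩
  induction n, hn using Nat.le_induction with
  | base =>
    refine existsLinearMatroid_of_corank_le_three (by omega) le_rfl hb hbr fun h' => ?_
    simp only [Prod.mk.injEq] at h'
    omega
  | succ n hn ih =>
    refine ExistsLinearMatroid.addLoop hb (ih ?_ ?_ (by omega))
    · exact hbr.trans (Nat.choose_le_choose _ hn)
    · simp only [ne_eq, Prod.mk.injEq]
      omega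

/-! ### Simple matroids on six elements -/

/-- The base axiom in its augmentation form: an independent set extends to a base inside its
union with any given base. -/
def HasAugmentation {α : Type*} [DecidableEq α] (F : Finset (Finset α)) : Prop :=
  ∀ I, ∀ B₀ ∈ F, I ⊆ B₀ → ∀ B ∈ F, ∃ B' ∈ F, I ⊆ B' ∧ B' ⊆ I ∪ B

/-- The points collinear with `p` and `q`, when `F` is the set of bases of a matroid of rank
three in which `p` and `q` are independent. -/
def lineThrough {α : Type*} [Fintype α] [DecidableEq α] (F : Finset (Finset α)) (p q : α) :
    Finset α :=
  {x | {p, q, x} ∉ F}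

section

variable {α : Type*} [Fintype α] [DecidableEq α] {F : Finset (Finset α)}

lemma not_mem_of_subset_lineThrough (h3 : ∀ B ∈ F, B.card = 3) (haug : HasAugmentation F)
    {p q : α} (hpq : p ≠ q) (hind : ∃ B ∈ F, {p, q} ⊆ B) {s : Finset α}
    (hs : s ⊆ lineThrough F p q) : s ∉ F := by
  intro hsF
  obtain ⟨B₀, hB₀, hI⟩ := hind
  obtain ⟨B, hB, hIB, hBs⟩ := haug _ B₀ hB₀ hI s hsF
  have hcard : ({p, q} : Finset α).card = 2 := Finset.card_pair hpq
  obtain ⟨x, hxB, hx⟩ := Finset.exists_mem_notMem_of_card_lt_card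
    (show ({p, q} : Finset α).card < B.card by rw [hcard, h3 B hB]; omega)
  have hxs : x ∈ s := (Finset.mem_union.1 (hBs hxB)).resolve_left hx
  have heq : ({p, q, x} : Finset α) = B := by
    refine Finset.eq_of_subset_of_card_le ?_ ?_
    · intro y hy
      simp only [Finset.mem_insert, Finset.mem_singleton] at hy
      rcases hy with rfl | rfl | rfl
      · exact hIB (by simp)
      · exact hIB (by simp)
      · exact hxB
    · have : ({p, q, x} : Finset α) = insert x {p, q} := by
        ext y; simp only [Finset.mem_insert, Finset.mem_singleton]; tauto
      rw [h3 B hB, this, Finset.card_insert_of_notMem hx, hcard]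
  have := hs hxs
  simp only [lineThrough, Finset.mem_filter, Finset.mem_univ, true_and] at this
  exact this (heq ▸ hB)

/-- A simple matroid of rank three on six elements does not have eleven bases: its nine dependent
triples would force a line of four points, and such a line forces twelve bases. -/
lemma card_ne_eleven_of_simple (hα : Fintype.card α = 6) (h3 : ∀ B ∈ F, B.card = 3)
    (haug : HasAugmentation F) (hsimple : ∀ p q : α, p ≠ q → ∃ B ∈ F, {p, q} ⊆ B) :
    F.card ≠ 11 := by
  intro h11
  set D : Finset (Finset α) := Finset.univ.powersetCard 3 \ F with hD
  have hFsub : F ⊆ Finset.univ.powersetCard 3 := fun B hB =>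
    Finset.mem_powersetCard.2 ⟨Finset.subset_univ _, h3 B hB⟩
  have hDcard : D.card = 9 := by
    rw [hD, Finset.card_sdiff_of_subset hFsub, Finset.card_powersetCard, Finset.card_univ, hα, h11]
    rfl
  have hline : ∀ p q : α, p ≠ q → (lineThrough F p q).powersetCard 3 ⊆ D := by
    intro p q hpq s hs
    rw [Finset.mem_powersetCard] at hs
    rw [hD, Finset.mem_sdiff, Finset.mem_powersetCard]
    exact ⟨⟨Finset.subset_univ _, hs.2⟩,
      not_mem_of_subset_lineThrough h3 haug hpq (hsimple p q hpq) hs.1⟩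
  have hle : ∀ p q : α, p ≠ q → (lineThrough F p q).card ≤ 4 := by
    intro p q hpq
    by_contra! hcon
    have h1 := Finset.card_le_card (hline p q hpq)
    rw [Finset.card_powersetCard, hDcard] at h1
    have h2 : Nat.choose 5 3 ≤ (lineThrough F p q).card.choose 3 := Nat.choose_le_choose 3 hcon
    exact absurd (h2.trans h1) (by decide)
  have hmem : ∀ p q x, x ∈ lineThrough F p q ↔ ({p, q, x} : Finset α) ∉ F := by
    intro p q x
    simp [lineThrough]
  -- nine triples without common pairs would have 27 distinct pairs among only 15
  obtain ⟨p, q, hpq, hfour⟩ : ∃ p q : α, p ≠ q ∧ 4 ≤ (lineThrough F p q).card := by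
    by_contra! hcon
    have hdisj : (D : Set (Finset α)).PairwiseDisjoint fun s => s.powersetCard 2 := by
      intro s hs t ht hst
      rw [Function.onFun, Finset.disjoint_left]
      intro P hPs hPt
      rw [Finset.mem_powersetCard] at hPs hPt
      obtain ⟨p, q, hpq, rfl⟩ := Finset.card_eq_two.1 hPs.2
      simp only [hD, Finset.coe_sdiff, Set.mem_sdiff, Finset.mem_coe, Finset.mem_powersetCard]
        at hs ht
      have hsub : ∀ u : Finset α, u ∉ F → u.card = 3 → {p, q} ⊆ u → u ⊆ lineThrough F p q := by
        intro u huF hu hpu x hx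
        rw [hmem]
        intro hx'
        have heq : ({p, q, x} : Finset α) = u := by
          refine Finset.eq_of_subset_of_card_le ?_ (by rw [h3 _ hx', hu])
          intro y hy
          simp only [Finset.mem_insert, Finset.mem_singleton] at hy
          rcases hy with rfl | rfl | rfl
          · exact hpu (by simp)
          · exact hpu (by simp)
          · exact hx
        exact huF (heq ▸ hx')
      have h1 := Finset.union_subset (hsub s hs.2 hs.1.2 hPs.1) (hsub t ht.2 ht.1.2 hPt.1)
      have h2 := Finset.card_le_card h1
      have h4 := hcon p q hpq
      have h5 : s = s ∪ t := Finset.eq_of_subset_of_card_le Finset.subset_union_left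
        (by rw [hs.1.2]; omega)
      have h6 : t = s ∪ t := Finset.eq_of_subset_of_card_le Finset.subset_union_right
        (by rw [ht.1.2]; omega)
      exact hst (h5.trans h6.symm)
    have h1 : (D.biUnion fun s => s.powersetCard 2) ⊆ Finset.univ.powersetCard 2 := by
      intro P hP
      rw [Finset.mem_biUnion] at hP
      obtain ⟨s, -, hP⟩ := hP
      exact Finset.mem_powersetCard.2 ⟨Finset.subset_univ _, (Finset.mem_powersetCard.1 hP).2⟩
    have h2 := Finset.card_le_card h1
    rw [Finset.card_biUnion hdisj, Finset.sum_const_nat (m := 3), hDcard, Finset.card_powersetCard,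
      Finset.card_univ, hα] at h2
    · revert h2
      decide
    · intro s hs
      rw [hD, Finset.mem_sdiff, Finset.mem_powersetCard] at hs
      rw [Finset.card_powersetCard, hs.1.2]
      rfl
  -- each pair on the four-point line is independent of both remaining points
  set Q := lineThrough F p q with hQ
  have hQ4 : Q.card = 4 := le_antisymm (hle p q hpq) hfour
  have hbase : ∀ P ∈ Q.powersetCard 2, ∀ z ∈ Qᶜ, insert z P ∈ F := by
    intro P hP z hz
    rw [Finset.mem_powersetCard] at hP
    obtain ⟨i, j, hij, rfl⟩ := Finset.card_eq_two.1 hP.2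
    by_contra hcon
    have hzl : z ∈ lineThrough F i j := by
      rw [hmem]
      have : ({i, j, z} : Finset α) = insert z {i, j} := by
        ext y; simp only [Finset.mem_insert, Finset.mem_singleton]; tauto
      rwa [this]
    have hQl : Q ⊆ lineThrough F i j := by
      intro x hx
      rw [hmem]
      refine not_mem_of_subset_lineThrough h3 haug hpq (hsimple p q hpq) ?_
      rw [← hQ]
      intro y hy
      simp only [Finset.mem_insert, Finset.mem_singleton] at hy
      rcases hy with rfl | rfl | rfl
      · exact hP.1 (by simp)
      · exact hP.1 (by simp)
      · exact hx
    have h1 := Finset.card_le_card (Finset.insert_subset hzl hQl)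
    rw [Finset.card_insert_of_notMem (Finset.mem_compl.1 hz)] at h1
    have := hle i j hij
    omega
  have hinj : ((Q.powersetCard 2 ×ˢ Qᶜ : Finset (Finset α × α)) : Set (Finset α × α)).InjOn
      fun x => insert x.2 x.1 := by
    rintro ⟨P, z⟩ hPz ⟨P', z'⟩ hPz' heq
    simp only [Finset.coe_product, Set.mem_prod, Finset.mem_coe, Finset.mem_powersetCard,
      Finset.mem_compl] at hPz hPz'
    dsimp only at heq
    have hz : z = z' := by
      have : z ∈ insert z' P' := heq ▸ Finset.mem_insert_self z P
      exact (Finset.mem_insert.1 this).resolve_right fun h => hPz.2 (hPz'.1.1 h)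
    subst hz
    have hP : P = P' := by
      rw [← Finset.erase_insert (fun h => hPz.2 (hPz.1.1 h)), heq,
        Finset.erase_insert (fun h => hPz'.2 (hPz'.1.1 h))]
    rw [hP]
  have hle12 := Finset.card_le_card_of_injOn (t := F) (fun x : Finset α × α => insert x.2 x.1)
    (by
      rintro ⟨P, z⟩ hPz
      rw [Finset.mem_coe, Finset.mem_product] at hPz
      exact hbase P hPz.1 z hPz.2) hinj
  rw [Finset.card_product, Finset.card_powersetCard, Finset.card_compl, hQ4, hα, h11] at hle12
  revert hle12
  decide

lemma exists_mem_of_card_eleven (hα : Fintype.card α = 6) (h3 : ∀ B ∈ F, B.card = 3)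
    (h11 : F.card = 11) (p : α) : ∃ B ∈ F, p ∈ B := by
  by_contra! hcon
  have h1 : F ⊆ (Finset.univ.erase p).powersetCard 3 := by
    intro B hB
    refine Finset.mem_powersetCard.2 ⟨fun x hx => ?_, h3 B hB⟩
    exact Finset.mem_erase.2 ⟨fun h => hcon B hB (h ▸ hx), Finset.mem_univ _⟩
  have h2 := Finset.card_le_card h1
  rw [Finset.card_powersetCard, Finset.card_erase_of_mem (Finset.mem_univ _), Finset.card_univ, hα,
    h11] at h2
  revert h2
  decide

end

/-! ### Matroids on six elements with a parallel pair -/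

/-- The six pairs in `{2, 3, 4, 5}`. -/
def pairOf : Fin 6 → Finset (Fin 6) :=
  ![{2, 3}, {2, 4}, {2, 5}, {3, 4}, {3, 5}, {4, 5}]

/-- The index in `pairOf` of the pair `{i + 2, j + 2}`; the diagonal values are irrelevant. -/
def pairIndex : Fin 4 → Fin 4 → Fin 6 :=
  ![![0, 0, 1, 2], ![0, 0, 3, 4], ![1, 3, 0, 5], ![2, 4, 5, 0]]

/-- The element of `{2, 3, 4, 5}` with index `i`. -/
def shiftTwo : Fin 4 → Fin 6 :=
  ![2, 3, 4, 5]

/-- All triples in `Fin 6`, sorted by their intersection with `{0, 1}`; the last family lists the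
triples in `{2, 3, 4, 5}` by their missing element. -/
def tripleOf : Fin 6 ⊕ Fin 6 ⊕ Fin 4 ⊕ Fin 4 → Finset (Fin 6) :=
  Sum.elim (fun p => insert 0 (pairOf p)) <| Sum.elim (fun p => insert 1 (pairOf p)) <|
    Sum.elim (fun i => {0, 1, shiftTwo i}) fun i => {2, 3, 4, 5} \ {shiftTwo i}

lemma tripleOf_injective : Function.Injective tripleOf := by decide +kernel

lemma image_tripleOf : Finset.univ.image tripleOf = Finset.univ.powersetCard 3 := by
  decide +kernel

set_option synthInstance.maxHeartbeats 200000 in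
set_option synthInstance.maxSize 4000 in
/-- Let `0` and `1` be parallel in a matroid of rank three on `Fin 6` without loops, let `n` tell
which pairs in `{2, 3, 4, 5}` extend `0` to a base, and `x i` whether the triple in `{2, 3, 4, 5}`
missing the element of index `i` is a base. The hypotheses are the count of eleven bases and
augmentation of a single element, of a pair `{c, d}` and of a pair `{0, f}`; they contradict each
other. -/
lemma parallel_pattern : ∀ (n : Fin 6 → Bool) (x : Fin 4 → Bool),
    2 * (∑ p, (n p).toNat) + ∑ i, (x i).toNat = 11 →
    (∀ i, x i = true → ∃ j, j ≠ i ∧ x j = true) →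
    (∀ c d e f : Fin 4, [c, d, e, f].Nodup → x e = true → n (pairIndex c e) = true →
      n (pairIndex c d) = true ∨ x f = true) →
    (∀ c d e f : Fin 4, [c, d, e, f].Nodup → n (pairIndex f e) = true →
      n (pairIndex c d) = true → n (pairIndex f c) = true ∨ n (pairIndex f d) = true) →
    False := by
  decide +kernel

lemma card_ne_eleven_of_parallel {F : Finset (Finset (Fin 6))} (h3 : ∀ B ∈ F, B.card = 3)
    (haug : HasAugmentation F) (hpar : ∀ B ∈ F, ¬ ({0, 1} : Finset (Fin 6)) ⊆ B) :
    F.card ≠ 11 := by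
  intro h11
  have hloop := exists_mem_of_card_eleven (by simp) h3 h11
  -- `0` and `1` are exchangeable, being parallel
  have hexch : ∀ a b : Fin 6, (∀ B ∈ F, ¬ ({a, b} : Finset (Fin 6)) ⊆ B) →
      ∀ P, a ∉ P → P.card = 2 → insert a P ∈ F → insert b P ∈ F := by
    intro a b hab P haP hP hF
    obtain ⟨B₀, hB₀, hb⟩ := hloop b
    obtain ⟨B, hB, hbB, hBsub⟩ := haug {b} B₀ hB₀ (by simpa using hb) _ hF
    have haB : a ∉ B := fun ha => hab B hB (by
      rw [Finset.insert_subset_iff]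
      exact ⟨ha, hbB⟩)
    have hsub : B ⊆ insert b P := by
      intro y hy
      have := hBsub hy
      simp only [Finset.mem_union, Finset.mem_singleton, Finset.mem_insert] at this ⊢
      rcases this with h | h | h
      · exact .inl h
      · exact absurd (h ▸ hy) haB
      · exact .inr h
    rwa [← Finset.eq_of_subset_of_card_le hsub
      (by rw [h3 B hB]; exact (Finset.card_insert_le _ _).trans (by omega))]
  have hpair : ∀ p, (0 : Fin 6) ∉ pairOf p ∧ (1 : Fin 6) ∉ pairOf p ∧ (pairOf p).card = 2 := by
    decide
  have h01 : ∀ p, insert 0 (pairOf p) ∈ F ↔ insert 1 (pairOf p) ∈ F := fun p =>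
    ⟨hexch 0 1 hpar _ (hpair p).1 (hpair p).2.2,
      hexch 1 0 (by simpa [Finset.pair_comm] using hpar) _ (hpair p).2.1 (hpair p).2.2⟩
  have hnone : ∀ i, ({0, 1, shiftTwo i} : Finset (Fin 6)) ∉ F := fun i h =>
    hpar _ h (by intro y hy; simp at hy ⊢; tauto)
  refine parallel_pattern (fun p => decide (insert 0 (pairOf p) ∈ F))
    (fun i => decide ({2, 3, 4, 5} \ {shiftTwo i} ∈ F)) ?_ ?_ ?_ ?_
  · have hsum : F.card = ∑ t, (decide (tripleOf t ∈ F)).toNat := by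
      have h1 : F = (Finset.univ.powersetCard 3).filter (· ∈ F) := by
        ext B
        simp only [Finset.mem_filter, Finset.mem_powersetCard, Finset.subset_univ, true_and]
        exact ⟨fun h => ⟨h3 B h, h⟩, fun h => h.2⟩
      conv_lhs => rw [h1]
      rw [← image_tripleOf, Finset.card_filter, Finset.sum_image tripleOf_injective.injOn]
      refine Finset.sum_congr rfl fun t _ => ?_
      by_cases h : tripleOf t ∈ F <;> simp [h]
    rw [h11] at hsum
    simp only [Fintype.sum_sum_type] at hsum
    change 11 = ∑ p, (decide (insert 0 (pairOf p) ∈ F)).toNat +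
      (∑ p, (decide (insert 1 (pairOf p) ∈ F)).toNat +
        (∑ i, (decide ({0, 1, shiftTwo i} ∈ F)).toNat +
          ∑ i, (decide ({2, 3, 4, 5} \ {shiftTwo i} ∈ F)).toNat)) at hsum
    have e1 : ∑ p, (decide (insert 1 (pairOf p) ∈ F)).toNat =
        ∑ p, (decide (insert 0 (pairOf p) ∈ F)).toNat :=
      Finset.sum_congr rfl fun p _ => by rw [decide_eq_decide.2 (h01 p)]
    have e2 : ∑ i, (decide ({0, 1, shiftTwo i} ∈ F)).toNat = 0 :=
      Finset.sum_eq_zero fun i _ => by simp [hnone]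
    omega
  · intro i hi
    simp only [decide_eq_true_eq] at hi ⊢
    obtain ⟨B₀, hB₀, hb⟩ := hloop (shiftTwo i)
    obtain ⟨B, hB, hbB, hBsub⟩ := haug {shiftTwo i} B₀ hB₀ (by simpa using hb) _ hi
    have hcard := h3 B hB
    have key : ∀ i : Fin 4, ∀ B : Finset (Fin 6), B.card = 3 → {shiftTwo i} ⊆ B →
        B ⊆ {shiftTwo i} ∪ ({2, 3, 4, 5} \ {shiftTwo i}) →
        ∃ j, j ≠ i ∧ B = {2, 3, 4, 5} \ {shiftTwo j} := by decide +kernel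
    obtain ⟨j, hj, rfl⟩ := key i B hcard hbB hBsub
    exact ⟨j, hj, hB⟩
  · intro c d e f hnd he hce
    simp only [decide_eq_true_eq] at he hce ⊢
    have hI : ∀ c d e f : Fin 4, [c, d, e, f].Nodup →
        ({shiftTwo c, shiftTwo d} : Finset (Fin 6)) ⊆ {2, 3, 4, 5} \ {shiftTwo e} := by
      decide +kernel
    obtain ⟨B, hB, hIB, hBsub⟩ := haug {shiftTwo c, shiftTwo d} _ he (hI c d e f hnd) _ hce
    have hcard := h3 B hB
    have key : ∀ c d e f : Fin 4, [c, d, e, f].Nodup → ∀ B : Finset (Fin 6), B.card = 3 →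
        {shiftTwo c, shiftTwo d} ⊆ B →
        B ⊆ {shiftTwo c, shiftTwo d} ∪ insert 0 (pairOf (pairIndex c e)) →
        B = insert 0 (pairOf (pairIndex c d)) ∨ B = {2, 3, 4, 5} \ {shiftTwo f} := by
      decide +kernel
    rcases key c d e f hnd B hcard hIB hBsub with rfl | rfl
    · exact .inl hB
    · exact .inr hB
  · intro c d e f hnd hfe hcd
    simp only [decide_eq_true_eq] at hfe hcd ⊢
    have hI : ∀ e f : Fin 4, f ≠ e →
        ({0, shiftTwo f} : Finset (Fin 6)) ⊆ insert 0 (pairOf (pairIndex f e)) := by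
      decide +kernel
    have hne : f ≠ e := by
      rintro rfl
      simp at hnd
    obtain ⟨B, hB, hIB, hBsub⟩ := haug {0, shiftTwo f} _ hfe (hI e f hne) _ hcd
    have hcard := h3 B hB
    have key : ∀ c d e f : Fin 4, [c, d, e, f].Nodup → ∀ B : Finset (Fin 6), B.card = 3 →
        {0, shiftTwo f} ⊆ B → B ⊆ {0, shiftTwo f} ∪ insert 0 (pairOf (pairIndex c d)) →
        B = insert 0 (pairOf (pairIndex f c)) ∨ B = insert 0 (pairOf (pairIndex f d)) := by
      decide +kernel
    rcases key c d e f hnd B hcard hIB hBsub with rfl | rfl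
    · exact .inl hB
    · exact .inr hB

open Classical in
/-- The bases of `M`, read through a numbering `g` of its ground set. -/
noncomputable def Matroid.baseIndices {α : Type*} (M : Matroid α) (g : Fin 6 → α) :
    Finset (Finset (Fin 6)) :=
  {s | M.IsBase (g '' s)}

section

variable {α : Type*} {M : Matroid α} {g : Fin 6 → α}

lemma Matroid.mem_baseIndices {s : Finset (Fin 6)} :
    s ∈ M.baseIndices g ↔ M.IsBase (g '' s) := by
  simp [Matroid.baseIndices]

lemma Matroid.exists_eq_image_of_subset_ground (hgE : Set.range g = M.E) {B : Set α}
    (hB : B ⊆ M.E) : ∃ s : Finset (Fin 6), g '' s = B := by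
  classical
  refine ⟨(g ⁻¹' B).toFinset, ?_⟩
  rw [Set.coe_toFinset, Set.image_preimage_eq_of_subset (hgE ▸ hB)]

lemma Matroid.hasAugmentation_baseIndices (hg : Function.Injective g) (hgE : Set.range g = M.E) :
    HasAugmentation (M.baseIndices g) := by
  intro I B₀ hB₀ hI B hB
  rw [Matroid.mem_baseIndices] at hB₀ hB
  have hIind : M.Indep (g '' I) := hB₀.indep.subset (Set.image_mono (by exact_mod_cast hI))
  obtain ⟨B', hB', h1, h2⟩ := hIind.exists_isBase_subset_union_isBase hB
  obtain ⟨s, rfl⟩ := Matroid.exists_eq_image_of_subset_ground hgE hB'.subset_ground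
  refine ⟨s, Matroid.mem_baseIndices.2 hB', ?_, ?_⟩
  · exact_mod_cast (Set.image_subset_image_iff hg).1 h1
  · rw [← Set.image_union] at h2
    exact_mod_cast (Set.image_subset_image_iff hg).1 h2

lemma Matroid.card_of_mem_baseIndices (hg : Function.Injective g) (hr : M.eRank = 3) :
    ∀ s ∈ M.baseIndices g, s.card = 3 := by
  intro s hs
  have h := (Matroid.mem_baseIndices.1 hs).encard_eq_eRank
  rw [hr, hg.encard_image, Set.encard_coe_eq_coe_finsetCard] at h
  exact_mod_cast h

lemma Matroid.card_baseIndices (hg : Function.Injective g) (hgE : Set.range g = M.E)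
    (hb : {B : Set α | M.IsBase B}.encard = 11) : (M.baseIndices g).card = 11 := by
  have himage : {B : Set α | M.IsBase B} =
      (fun s : Finset (Fin 6) => g '' s) '' (M.baseIndices g : Set (Finset (Fin 6))) := by
    ext B
    simp only [Set.mem_ofPred_eq, Set.mem_image, Finset.mem_coe, Matroid.mem_baseIndices]
    constructor
    · intro hB
      obtain ⟨s, rfl⟩ := Matroid.exists_eq_image_of_subset_ground hgE hB.subset_ground
      exact ⟨s, hB, rfl⟩
    · rintro ⟨s, hs, rfl⟩
      exact hs
  have hinj : Function.Injective fun s : Finset (Fin 6) => g '' s := fun s t hst =>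
    Finset.coe_injective (hg.image_injective hst)
  rw [himage, hinj.encard_image, Set.encard_coe_eq_coe_finsetCard] at hb
  exact_mod_cast hb

end

lemma Matroid.not_isTriple_six_three_eleven {α : Type*} (M : Matroid α) :
    ¬ M.IsTriple 6 3 11 := by
  classical
  rintro ⟨hE, hr, hb⟩
  have hfin : M.E.Finite := Set.finite_of_encard_eq_coe hE
  have hcard : hfin.toFinset.card = 6 := by
    rw [hfin.encard_eq_coe_toFinset_card] at hE
    exact_mod_cast hE
  have hequiv : ∀ e : Fin 6 ≃ hfin.toFinset,
      Function.Injective (fun i => (e i : α)) ∧ Set.range (fun i => (e i : α)) = M.E := by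
    intro e
    refine ⟨Subtype.val_injective.comp e.injective, ?_⟩
    ext x
    simp only [Set.mem_range]
    constructor
    · rintro ⟨i, rfl⟩
      exact hfin.mem_toFinset.1 (e i).2
    · intro hx
      exact ⟨e.symm ⟨x, by simpa using hx⟩, by simp⟩
  have hr' : M.eRank = 3 := hr
  have hb' : {B : Set α | M.IsBase B}.encard = 11 := hb
  by_cases hpar : ∃ a ∈ M.E, ∃ b ∈ M.E, a ≠ b ∧ ∀ B, M.IsBase B → ¬ ({a, b} : Set α) ⊆ B
  · obtain ⟨a, ha, b, hb0, hab, hpar⟩ := hpar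
    obtain ⟨e, he⟩ := Finset.exists_equiv_extend_of_card_eq (α := Fin 6) (t := hfin.toFinset)
      (by rw [hcard, Fintype.card_fin]) (s := {0, 1}) (f := fun i => if i = 0 then a else b)
      (by intro x hx; simp at hx; rcases hx with rfl | rfl <;> simpa)
      (by
        intro i hi j hj hij
        simp only [Finset.coe_insert, Finset.coe_singleton, Set.mem_insert_iff,
          Set.mem_singleton_iff] at hi hj
        rcases hi with rfl | rfl <;> rcases hj with rfl | rfl <;> simp_all)
    obtain ⟨hg, hgE⟩ := hequiv e
    refine card_ne_eleven_of_parallel (Matroid.card_of_mem_baseIndices hg hr')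
      (Matroid.hasAugmentation_baseIndices hg hgE) ?_ (Matroid.card_baseIndices hg hgE hb')
    intro s hs h01
    refine hpar _ (Matroid.mem_baseIndices.1 hs) ?_
    have h0 := he 0 (by simp)
    have h1 := he 1 (by simp)
    simp only [if_true, one_ne_zero, if_false] at h0 h1
    rintro y (rfl | rfl)
    · exact ⟨0, by exact_mod_cast h01 (by simp), h0⟩
    · exact ⟨1, by exact_mod_cast h01 (by simp), h1⟩
  · push Not at hpar
    have e : Fin 6 ≃ hfin.toFinset := (Finset.equivFinOfCardEq hcard).symm
    obtain ⟨hg, hgE⟩ := hequiv e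
    refine card_ne_eleven_of_simple (by simp) (Matroid.card_of_mem_baseIndices hg hr')
      (Matroid.hasAugmentation_baseIndices hg hgE) ?_ (Matroid.card_baseIndices hg hgE hb')
    intro i j hij
    obtain ⟨B, hB, hsub⟩ := hpar (e i) (hgE.subset ⟨i, rfl⟩) (e j)
      (hgE.subset ⟨j, rfl⟩) (hg.ne hij)
    obtain ⟨s, rfl⟩ := Matroid.exists_eq_image_of_subset_ground hgE hB.subset_ground
    refine ⟨s, Matroid.mem_baseIndices.2 hB, ?_⟩
    intro k hk
    have hk' : (fun i => (e i : α)) k ∈ (fun i => (e i : α)) '' s := by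
      refine hsub ?_
      simp only [Finset.mem_insert, Finset.mem_singleton] at hk
      rcases hk with rfl | rfl <;> simp
    simpa using (hg.mem_set_image).1 hk'

theorem theorem4p4 :
    (∀ n r b : ℕ, 1 ≤ b → b ≤ (r + 3).choose r → b ≤ n.choose r → (n, r, b) ≠ (6, 3, 11) →
      ExistsLinearMatroid n r b) ∧
    (∀ n r b : ℕ, r ≤ n → n ≤ r + 3 → 1 ≤ b → b ≤ n.choose r → (n, r, b) ≠ (6, 3, 11) →
      ExistsLinearMatroid n r b) ∧
    (∀ (α : Type*) (M : Matroid α), ¬ M.IsTriple 6 3 11) :=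
  ⟨fun _ _ _ hb hbr hbn h => existsLinearMatroid_of_le_choose hb hbr hbn h,
    fun _ _ _ hr hn hb hbn h => existsLinearMatroid_of_corank_le_three hr hn hb hbn h,
    fun _ M => M.not_isTriple_six_three_eleven⟩
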